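/- Let $M\ge 0$, $\hbar>0$, $E_J>0$, $\omega_1,\dots,\omega_M>0$ and $\lambda_1,\dots,\lambda_M\in\mathbb R$, and let $a_n,a_n^\dagger$ be the ladder operators of $M$ bosonic modes ($[a_m,a_n^\dagger]=\delta_{mn}$) with vacuum $|0\rangle$, acting on $L^2(\mathbb R^M)$ (Schrödinger representation). Consider the self-adjoint Hamiltonian $$H=\sum_{n=1}^M\hbar\omega_n a_n^\dagger a_n-E_J\cos\Bigl(\sum_{n=1}^M\lambda_n(a_n+a_n^\dagger)\Bigr),$$ and let $E_0$ be its ground state energy, i.e. its lowest eigenvalue (which exists). For $r=(r_1,\dots,r_M)\in\mathbb R^M$ let $$|\Psi_{\mathrm{var}}(r)\rangle=\prod_{n=1}^M S_n(r_n)|0\rangle,\qquad S_n(r_n)=\exp\bigl[(r_na_n^2-r_n(a_n^\dagger)^2)/2\bigr],$$ where $S_n$ is the strongly continuous unitary group generated by $\tfrac12(a_n^2-(a_n^\dagger)^2)$, and let $$E_{\mathrm{var}}(r)=\sum_{n=1}^M\hbar\omega_n\sinh^2r_n-E_J\exp\Bigl(-\tfrac12\sum_{m=1}^M\lambda_m^2e^{-2r_m}\Bigr).$$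 (1) For every $r$ the vector $\Psi_{\mathrm{var}}(r)$ is normalized, lies in the domain of $H$, and $\langle\Psi_{\mathrm{var}}(r)|H|\Psi_{\mathrm{var}}(r)\rangle=E_{\mathrm{var}}(r)$. The function $E_{\mathrm{var}}$ has a global minimizer on $\mathbb R^M$, and $E_0\le E_{\mathrm{var}}(r^*)$ for every minimizer $r^*$. (2) Let $M=1$, and fix $\hbar,E_J,\omega>0$. There are constants $C,\delta>0$, depending only on $\hbar,E_J,\omega$, such that for all real $\lambda$ with $|\lambda|<\delta$ and every minimizer $r^*$ of $r\mapsto\hbar\omega\sinh^2r-E_J\exp(-\tfrac12\lambda^2e^{-2r})$, $$\Bigl|r^*-\frac{\lambda^2E_J}{2\hbar\omega}\Bigr|\le C\lambda^4\qquad\text{and}\qquad\bigl|E_{\mathrm{var}}(r^*)-E_0\bigr|\le C\lambda^4 .$$ -/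

import Mathlib

/-!  The Schrödinger model of `M` bosonic modes.

The Hilbert space is `L²(ℝ^M; ℂ)` and the coordinates are scaled so that `x n` is the position
quadrature `X n = a n + a† n`; then `a n = x n / 2 + ∂ n`, `a† n = x n / 2 - ∂ n`,
`[a m, a† n] = δ m n`, and the vacuum is a Gaussian with `⟨X n ^ 2⟩ = 1`. All unbounded operators are
given on the Schwartz space `𝓢(ℝ^M; ℂ)`, which they map to itself. -/

open scoped SchwartzMap

noncomputable section

namespace SqueezedVacuum

/-- Configuration space of `M` modes. -/
abbrev Conf (M : ℕ) : Type := EuclideanSpace ℝ (Fin M)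

/-- Schwartz functions, the common core of all the operators below. -/
abbrev Core (M : ℕ) : Type := 𝓢(Conf M, ℂ)

/-- The Hilbert space of `M` modes. -/
abbrev Hilb (M : ℕ) : Type := MeasureTheory.Lp ℂ 2 (MeasureTheory.volume : MeasureTheory.Measure (Conf M))

/-- The inclusion of Schwartz functions into `L²`. -/
def incl {M : ℕ} (φ : Core M) : Hilb M := φ.toLp 2

/-- Multiplication by half the `n`-th coordinate. -/
def halfPos {M : ℕ} (n : Fin M) : Core M →L[ℂ] Core M :=
  SchwartzMap.smulLeftCLM ℂ (fun x : Conf M => ((x n / 2 : ℝ) : ℂ))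

/-- The partial derivative in the `n`-th coordinate. -/
def partialD {M : ℕ} (n : Fin M) : Core M →L[ℂ] Core M :=
  LineDeriv.lineDerivOpCLM ℂ (Core M) (EuclideanSpace.single n (1 : ℝ))

/-- The annihilation operator of mode `n`. -/
def annih {M : ℕ} (n : Fin M) : Core M →L[ℂ] Core M := halfPos n + partialD n

/-- The creation operator of mode `n`. -/
def creat {M : ℕ} (n : Fin M) : Core M →L[ℂ] Core M := halfPos n - partialD n

/-- The junction phase `θ = ∑ n, lam n * (a n + a† n)` in the position representation, where it is
multiplication by this function. -/
def phase {M : ℕ} (lam : Fin M → ℝ) (x : Conf M) : ℝ := ∑ n, lam n * x n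

/-- The operator `cos θ`: multiplication by the cosine of the function that represents `θ`. -/
def cosPhase {M : ℕ} (lam : Fin M → ℝ) : Core M →L[ℂ] Core M :=
  SchwartzMap.smulLeftCLM ℂ (fun x : Conf M => ((Real.cos (phase lam x) : ℝ) : ℂ))

/-- The Hamiltonian `∑ n, ħ ω n a† n a n - EJ cos (∑ n, lam n (a n + a† n))` on Schwartz functions. -/
def hamCore {M : ℕ} (hbar EJ : ℝ) (ω lam : Fin M → ℝ) : Core M →L[ℂ] Core M :=
  (∑ n, ((hbar * ω n : ℝ) : ℂ) • (creat n ∘L annih n)) - (EJ : ℂ) • cosPhase lam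

/-- The self-adjoint Hamiltonian on `L²`, as a graph: `ψ` is in its domain and is mapped to `χ`.
It is the Hilbert space adjoint of `hamCore` (equivalently its closure, since `hamCore` is essentially
self-adjoint), so `χ = H ψ` holds in the sense of tempered distributions. -/
def IsHamImage {M : ℕ} (hbar EJ : ℝ) (ω lam : Fin M → ℝ) (ψ χ : Hilb M) : Prop :=
  ∀ φ : Core M, inner ℂ (incl (hamCore hbar EJ ω lam φ)) ψ = inner ℂ (incl φ) χ

/-- `E` is an eigenvalue of the Hamiltonian. -/
def IsEnergyLevel {M : ℕ} (hbar EJ : ℝ) (ω lam : Fin M → ℝ) (E : ℝ) : Prop :=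
  ∃ ψ : Hilb M, ψ ≠ 0 ∧ IsHamImage hbar EJ ω lam ψ ((E : ℂ) • ψ)

/-- The ground state energy: the lowest eigenvalue of the Hamiltonian. -/
def groundEnergy {M : ℕ} (hbar EJ : ℝ) (ω lam : Fin M → ℝ) : ℝ :=
  sInf {E : ℝ | IsEnergyLevel hbar EJ ω lam E}

/-- `U t = exp (t K)`: a strongly continuous one-parameter unitary group on `L²` whose generator
extends `K`. There is at most one such group when `K` is essentially skew-adjoint. -/
structure IsExpGroup {M : ℕ} (K : Core M →L[ℂ] Core M) (U : ℝ → (Hilb M →L[ℂ] Hilb M)) : Prop where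
  map_zero : U 0 = 1
  map_add : ∀ s t : ℝ, U (s + t) = U s * U t
  norm_map : ∀ (t : ℝ) (ψ : Hilb M), ‖U t ψ‖ = ‖ψ‖
  continuous : ∀ ψ : Hilb M, Continuous (fun t => U t ψ)
  hasDerivAt : ∀ φ : Core M, HasDerivAt (fun t => U t (incl φ)) (incl (K φ)) 0

open Classical in
/-- The one-parameter unitary group `t ↦ exp (t K)` generated by `K` (`1` if there is none). -/
def expGroup {M : ℕ} (K : Core M →L[ℂ] Core M) : ℝ → (Hilb M →L[ℂ] Hilb M) :=
  if h : ∃ U, IsExpGroup K U then h.choose else fun _ => 1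

/-- The generator `(a n ^ 2 - a† n ^ 2) / 2` of squeezing in mode `n`. -/
def squeezeGen {M : ℕ} (n : Fin M) : Core M →L[ℂ] Core M :=
  (1 / 2 : ℂ) • (annih n ∘L annih n - creat n ∘L creat n)

/-- The squeezing operator `S n r = exp ((r a n ^ 2 - r a† n ^ 2) / 2)`. -/
def squeezeOp {M : ℕ} (n : Fin M) (r : ℝ) : Hilb M →L[ℂ] Hilb M := expGroup (squeezeGen n) r

/-- The normalized Gaussian `(2 π) ^ (-M / 4) exp (-‖x‖ ^ 2 / 4)`. -/
def gauss (M : ℕ) (x : Conf M) : ℝ :=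
  (2 * Real.pi) ^ (-(M : ℝ) / 4) * Real.exp (-(‖x‖ ^ 2 / 4))

/-- Every annihilation operator `x n / 2 + ∂ n` kills the Gaussian. -/
theorem gauss_annih {M : ℕ} (n : Fin M) (x : Conf M) :
    x n / 2 * gauss M x + fderiv ℝ (gauss M) x (EuclideanSpace.single n (1 : ℝ)) = 0 := by
  have h1 : HasFDerivAt (fun y : Conf M => ‖y‖ ^ 2) (2 • innerSL ℝ x) x :=
    (hasStrictFDerivAt_norm_sq x).hasFDerivAt
  have h2 : HasFDerivAt (fun y : Conf M => -(‖y‖ ^ 2 / 4)) (-((4 : ℝ)⁻¹ • (2 • innerSL ℝ x))) x := by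
    have := (h1.const_mul (4 : ℝ)⁻¹).neg
    refine this.congr_of_eventuallyEq (Filter.Eventually.of_forall fun y => ?_)
    simp [div_eq_inv_mul]
  have h3 : HasFDerivAt (gauss M) _ x := (h2.exp).const_mul ((2 * Real.pi) ^ (-(M : ℝ) / 4))
  rw [h3.fderiv]
  simp [gauss, EuclideanSpace.inner_single_right]
  ring

theorem gauss_memLp (M : ℕ) :
    MeasureTheory.MemLp (fun x : Conf M => (gauss M x : ℂ)) 2 MeasureTheory.volume := by
  have hc : Continuous (fun x : Conf M => (gauss M x : ℂ)) := by
    unfold gauss; fun_prop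
  rw [MeasureTheory.memLp_two_iff_integrable_sq_norm hc.aestronglyMeasurable]
  have h := GaussianFourier.integrable_cexp_neg_mul_sq_norm_add (V := Conf M) (b := 1 / 2)
    (by norm_num) 0 0
  refine (h.norm.const_mul (((2 * Real.pi) ^ (-(M : ℝ) / 4)) ^ 2)).congr
    (Filter.Eventually.of_forall fun x => ?_)
  simp only [gauss, Complex.norm_real, Complex.norm_exp, Real.norm_eq_abs, sq_abs, mul_pow]
  congr 1
  rw [← Real.exp_nat_mul]
  congr 1
  simp [← Complex.ofReal_pow]
  ring

/-- The vacuum of all modes. -/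
def vacuum (M : ℕ) : Hilb M := (gauss_memLp M).toLp _

/-- The product squeezed vacuum `∏ n, S n (r n) |0⟩`. -/
def squeezedVacuum {M : ℕ} (r : Fin M → ℝ) : Hilb M :=
  (List.ofFn fun n => squeezeOp n (r n)).prod (vacuum M)

/-- The variational energy
`∑ n, ħ ω n sinh² (r n) - EJ exp (-(1/2) ∑ m, lam m ^ 2 exp (-2 r m))`. -/
def varEnergy {M : ℕ} (hbar EJ : ℝ) (ω lam r : Fin M → ℝ) : ℝ :=
  (∑ n, hbar * ω n * Real.sinh (r n) ^ 2) -
    EJ * Real.exp (-(1 / 2) * ∑ m, lam m ^ 2 * Real.exp (-2 * r m))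

/-- The parameters `r` minimize the variational energy. -/
def IsOptimal {M : ℕ} (hbar EJ : ℝ) (ω lam r : Fin M → ℝ) : Prop :=
  ∀ s : Fin M → ℝ, varEnergy hbar EJ ω lam r ≤ varEnergy hbar EJ ω lam s

theorem coord_growth {M : ℕ} (n : Fin M) :
    (fun x : Conf M => ((x n / 2 : ℝ) : ℂ)).HasTemperateGrowth := by
  have h : (fun x : Conf M => ((x n / 2 : ℝ) : ℂ)) =
      ⇑((Complex.ofRealCLM).comp ((1 / 2 : ℝ) • (EuclideanSpace.proj (𝕜 := ℝ) n))) := by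
    funext x
    simp [div_eq_inv_mul]
  rw [h]
  exact ContinuousLinearMap.hasTemperateGrowth _

theorem cosPhase_growth {M : ℕ} (lam : Fin M → ℝ) :
    (fun x : Conf M => ((Real.cos (phase lam x) : ℝ) : ℂ)).HasTemperateGrowth := by
  have h1 : Real.cos.HasTemperateGrowth := by
    refine ⟨Real.contDiff_cos, fun n => ⟨0, 1, fun x => ?_⟩⟩
    rw [norm_iteratedFDeriv_eq_norm_iteratedDeriv]
    simpa using Real.abs_iteratedDeriv_cos_le_one n x
  have h2 : phase lam = ⇑(∑ n, lam n • (EuclideanSpace.proj (𝕜 := ℝ) n : Conf M →L[ℝ] ℝ)) := by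
    funext x
    simp [phase]
  have h3 : (phase lam).HasTemperateGrowth := by
    rw [h2]
    exact ContinuousLinearMap.hasTemperateGrowth _
  exact Function.HasTemperateGrowth.comp Function.Complex.hasTemperateGrowth_ofReal (h1.comp h3)

/-- The operator `cosPhase` is multiplication by `cos θ`. -/
theorem cosPhase_apply {M : ℕ} (lam : Fin M → ℝ) (φ : Core M) (x : Conf M) :
    cosPhase lam φ x = (Real.cos (phase lam x) : ℂ) * φ x := by
  rw [cosPhase, SchwartzMap.smulLeftCLM_apply_apply (cosPhase_growth lam), smul_eq_mul]

/-- The quadrature `a n + a† n` is multiplication by the `n`-th coordinate. -/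
theorem quadrature_apply {M : ℕ} (n : Fin M) (φ : Core M) (x : Conf M) :
    (annih n + creat n) φ x = (x n : ℂ) * φ x := by
  have h : halfPos n φ x = ((x n / 2 : ℝ) : ℂ) * φ x := by
    rw [halfPos, SchwartzMap.smulLeftCLM_apply_apply (coord_growth n), smul_eq_mul]
  simp [annih, creat, h]
  ring

end SqueezedVacuum

end

/-! The free Hamiltonian `∑ n, ħ ω n a† n a n` is diagonal in the number states, the Hermite functions
`∏ n, (a† n) ^ (k n) |0⟩`. They are orthogonal because the number operators are symmetric, and complete
because a vector `f` orthogonal to all of them is orthogonal to every polynomial times the Gaussian, so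
that the Fourier transform of `gauss * f` vanishes (`eq_zero_of_inner_numState`). In this Hilbert basis
the self-adjoint Hamiltonian, defined as the adjoint of `hamCore`, becomes a maximal diagonal operator
plus the bounded operator `-EJ cos θ` (`isHamImage_iff`).

For a diagonal operator with finitely many eigenvalues below each level, plus a bounded symmetric
operator, the sets of bounded energy in the unit sphere are compact. Hence the quadratic form attains its
minimum there, the first variation along the basis vectors shows that a minimizer is an eigenvector, and
the minimum bounds the mean energy of every vector in the domain from below (`exists_ground_state`).
This gives the ground state energy and the variational principle.

The squeezing generator is `x n ∂ n + 1 / 2`, so squeezing is the unitary dilation of one coordinate.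
Dilations preserve Schwartz functions and are differentiable on them in `L²` by dominated convergence, so
they form an exponential group, and any other exponential group agrees with them on Schwartz functions
(`isometryGroup_apply_eq`). The squeezed vacuum is therefore a dilated Gaussian (`squeezedVacuum_eq`), and
its energy follows from `a n ψ = -2 sinh (r n) ψ'`, where `ψ'` is the dilate of `x n / 2` times the vacuum,
and from the characteristic function of a Gaussian.

For one mode and a small coupling, the stationarity condition `ħ ω sinh (2 r) = EJ lam ^ 2 (1 + O(lam ^ 2))`
locates the minimizer. Its energy lies between the ground state energy and the energy
`-EJ exp (-lam ^ 2 / 2)` of the unsqueezed vacuum. The latter exceeds the ground state energy by at most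
`O(lam ^ 4)`: as `1 - cos θ` is nonnegative and the free Hamiltonian has the gap `ħ ω` above the vacuum, the
ground state energy lies below the vacuum mean by at most a multiple of the square of
`‖(1 - cos θ) |0⟩‖ = O(lam ^ 2)` (`gap_lower_bound`, `groundEnergy_lower_bound`). -/

noncomputable section

namespace SqueezedVacuum

open MeasureTheory Filter Topology
open scoped LineDeriv ComplexConjugate FourierTransform RealInnerProductSpace ENNReal

variable {M : ℕ}

/-! ### Ladder operators on Schwartz functions -/

/-- The inclusion of Schwartz functions into `L²` as a continuous linear map. -/
def inclL (M : ℕ) : Core M →L[ℂ] Hilb M := SchwartzMap.toLpCLM ℂ ℂ 2 volume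

theorem incl_add (φ η : Core M) : incl (φ + η) = incl φ + incl η := map_add (inclL M) φ η

theorem incl_sub (φ η : Core M) : incl (φ - η) = incl φ - incl η := map_sub (inclL M) φ η

theorem incl_smul (c : ℂ) (φ : Core M) : incl (c • φ) = c • incl φ := map_smul (inclL M) c φ

theorem incl_zero : incl (0 : Core M) = 0 := map_zero (inclL M)

theorem incl_sum {ι : Type*} (s : Finset ι) (f : ι → Core M) :
    incl (∑ i ∈ s, f i) = ∑ i ∈ s, incl (f i) := map_sum (inclL M) f s

theorem incl_injective : Function.Injective (incl : Core M → Hilb M) :=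
  SchwartzMap.injective_toLp 2 volume

theorem denseRange_incl : DenseRange (incl : Core M → Hilb M) :=
  SchwartzMap.denseRange_toLpCLM (F := ℂ) (E := Conf M) (p := 2) (μ := volume) (by simp)

theorem inner_incl (φ η : Core M) :
    inner ℂ (incl φ) (incl η) = ∫ x, conj (φ x) * η x := by
  refine (SchwartzMap.inner_toL2_toL2_eq φ η volume).trans ?_
  simp [RCLike.inner_apply, mul_comm]

theorem ofReal_norm_sq (v : Hilb M) : ((‖v‖ : ℝ) : ℂ) ^ 2 = inner ℂ v v :=
  (inner_self_eq_norm_sq_to_K (𝕜 := ℂ) v).symm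

theorem norm_sq_incl (φ : Core M) : ‖incl φ‖ ^ 2 = ∫ x, ‖φ x‖ ^ 2 := by
  have h : ((‖incl φ‖ ^ 2 : ℝ) : ℂ) = ((∫ x, ‖φ x‖ ^ 2 : ℝ) : ℂ) := by
    rw [← integral_complex_ofReal]
    push_cast
    rw [ofReal_norm_sq, inner_incl]
    congr 1
    ext x
    simp [← Complex.normSq_eq_conj_mul_self, Complex.normSq_eq_norm_sq]
  exact_mod_cast h

theorem halfPos_apply (n : Fin M) (φ : Core M) (x : Conf M) :
    halfPos n φ x = ((x n / 2 : ℝ) : ℂ) * φ x := by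
  rw [halfPos, SchwartzMap.smulLeftCLM_apply_apply (coord_growth n), smul_eq_mul]

theorem partialD_apply (n : Fin M) (φ : Core M) (x : Conf M) :
    partialD n φ x = fderiv ℝ φ x (EuclideanSpace.single n 1) := by
  simp only [partialD, LineDeriv.lineDerivOpCLM_apply]
  exact SchwartzMap.lineDerivOp_apply_eq_fderiv _ _ _

theorem annih_eq (n : Fin M) (φ : Core M) : annih n φ = halfPos n φ + partialD n φ := rfl

theorem creat_eq (n : Fin M) (φ : Core M) : creat n φ = halfPos n φ - partialD n φ := rfl

theorem inner_halfPos (n : Fin M) (φ η : Core M) :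
    inner ℂ (incl (halfPos n φ)) (incl η) = inner ℂ (incl φ) (incl (halfPos n η)) := by
  rw [inner_incl, inner_incl]
  congr 1
  ext x
  rw [halfPos_apply, halfPos_apply, map_mul, Complex.conj_ofReal]
  ring

theorem inner_partialD (n : Fin M) (φ η : Core M) :
    inner ℂ (incl (partialD n φ)) (incl η) = -inner ℂ (incl φ) (incl (partialD n η)) := by
  rw [inner_incl, inner_incl]
  have h := SchwartzMap.integral_bilinear_lineDerivOp_right_eq_neg_left (μ := volume) φ η
    ((ContinuousLinearMap.mul ℝ ℂ).comp (Complex.conjCLE : ℂ →L[ℝ] ℂ))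
    (EuclideanSpace.single n (1 : ℝ))
  exact neg_eq_iff_eq_neg.mp h.symm

/-- On Schwartz functions `a†` is the adjoint of `a`: integration by parts. -/
theorem inner_annih (n : Fin M) (φ η : Core M) :
    inner ℂ (incl (annih n φ)) (incl η) = inner ℂ (incl φ) (incl (creat n η)) := by
  rw [annih_eq, creat_eq, incl_add, incl_sub, inner_add_left, inner_sub_right, inner_halfPos,
    inner_partialD, sub_eq_add_neg]

theorem inner_creat (n : Fin M) (φ η : Core M) :
    inner ℂ (incl (creat n φ)) (incl η) = inner ℂ (incl φ) (incl (annih n η)) := by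
  rw [← inner_conj_symm, ← inner_annih, inner_conj_symm]

theorem partialD_halfPos (m n : Fin M) (φ : Core M) :
    partialD m (halfPos n φ) =
      halfPos n (partialD m φ) + (if m = n then (1 / 2 : ℂ) else 0) • φ := by
  ext x
  have h1 : (halfPos n φ : Conf M → ℂ) = fun y => ((y n / 2 : ℝ) : ℂ) * φ y :=
    funext (halfPos_apply n φ)
  have h2 : HasFDerivAt (fun y : Conf M => ((y n / 2 : ℝ) : ℂ))
      ((Complex.ofRealCLM).comp ((1 / 2 : ℝ) • (EuclideanSpace.proj (𝕜 := ℝ) n))) x := by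
    convert! ((Complex.ofRealCLM).comp
      ((1 / 2 : ℝ) • (EuclideanSpace.proj (𝕜 := ℝ) n : Conf M →L[ℝ] ℝ))).hasFDerivAt (x := x) using 1
    ext y
    simp [div_eq_inv_mul]
  have h3 := h2.mul (φ.hasFDerivAt x)
  rw [partialD_apply, h1]
  erw [h3.fderiv]
  simp only [add_apply, smul_apply, halfPos_apply, partialD_apply, ContinuousLinearMap.comp_apply]
  by_cases h : m = n
  · subst h; simp
    ring
  · simp [h, Ne.symm h]

theorem partialD_comm (m n : Fin M) (φ : Core M) :
    partialD m (partialD n φ) = partialD n (partialD m φ) := by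
  have key : ∀ (m n : Fin M) (x : Conf M), partialD m (partialD n φ) x =
      fderiv ℝ (fderiv ℝ φ) x (EuclideanSpace.single m 1) (EuclideanSpace.single n 1) := by
    intro m n x
    have h1 : (partialD n φ : Conf M → ℂ) =
        fun y => fderiv ℝ φ y (EuclideanSpace.single n 1) := funext (partialD_apply n φ)
    have h2 : DifferentiableAt ℝ (fderiv ℝ φ) x :=
      ((φ.smooth 2).fderiv_right (m := 1) (by norm_num)).differentiable (by norm_num) x
    rw [partialD_apply, h1, fderiv_clm_apply h2 (differentiableAt_const _)]
    simp
  ext x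
  rw [key, key]
  exact ((φ.smooth 2).contDiffAt.isSymmSndFDerivAt (by simp)) _ _

theorem halfPos_comm (m n : Fin M) (φ : Core M) :
    halfPos m (halfPos n φ) = halfPos n (halfPos m φ) := by
  ext x
  simp only [halfPos_apply]
  ring

theorem creat_comm (m n : Fin M) (φ : Core M) :
    creat m (creat n φ) = creat n (creat m φ) := by
  simp only [creat_eq, map_sub, partialD_halfPos, halfPos_comm m n, partialD_comm m n]
  simp only [eq_comm (a := m) (b := n)]
  abel

/-- The canonical commutation relation `[a m, a† n] = δ m n`. -/
theorem annih_creat (m n : Fin M) (φ : Core M) :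
    annih m (creat n φ) = creat n (annih m φ) + (if m = n then (1 : ℂ) else 0) • φ := by
  simp only [creat_eq, annih_eq, map_sub, map_add, partialD_halfPos, halfPos_comm m n,
    partialD_comm m n]
  by_cases h : m = n
  · subst h
    simp only [if_true]
    module
  · simp only [h, Ne.symm h, if_false]
    module

theorem halfPos_eq (n : Fin M) (φ : Core M) :
    halfPos n φ = (1 / 2 : ℂ) • (annih n φ + creat n φ) := by
  rw [annih_eq, creat_eq]
  module

theorem norm_sq_creat (n : Fin M) (φ : Core M) :
    ‖incl (creat n φ)‖ ^ 2 = ‖incl (annih n φ)‖ ^ 2 + ‖incl φ‖ ^ 2 := by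
  have h : ((‖incl (creat n φ)‖ ^ 2 : ℝ) : ℂ) =
      ((‖incl (annih n φ)‖ ^ 2 + ‖incl φ‖ ^ 2 : ℝ) : ℂ) := by
    push_cast
    rw [ofReal_norm_sq, ofReal_norm_sq, ofReal_norm_sq, inner_creat, annih_creat, inner_annih, incl_add, inner_add_right]
    simp
  exact_mod_cast h

theorem creat_injective (n : Fin M) : Function.Injective (creat n) := by
  refine (injective_iff_map_eq_zero (creat n)).2 fun φ h => ?_
  have h1 := norm_sq_creat n φ
  rw [h, incl_zero, norm_zero] at h1
  have h2 : ‖incl φ‖ = 0 := by nlinarith [sq_nonneg ‖incl (annih n φ)‖, norm_nonneg (incl φ)]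
  exact incl_injective ((norm_eq_zero.1 h2).trans incl_zero.symm)

/-! ### The Gaussian as a Schwartz function -/

theorem gauss_pos (x : Conf M) : 0 < gauss M x := by
  unfold gauss
  positivity

theorem gauss_ofReal_contDiff : ContDiff ℝ (⊤ : ℕ∞) (fun x : Conf M => (gauss M x : ℂ)) := by
  have h : ContDiff ℝ (⊤ : ℕ∞) (gauss M) :=
    contDiff_const.mul (((contDiff_norm_sq ℝ).div_const 4).neg.exp)
  exact Complex.ofRealCLM.contDiff.comp h

/-- The linear map `x ↦ -⟪x, ·⟫ / 2`, the logarithmic derivative of the Gaussian. -/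
def gaussLog (M : ℕ) : Conf M →L[ℝ] (Conf M →L[ℝ] ℂ) :=
  (-(1 / 2 : ℝ)) • (ContinuousLinearMap.compL ℝ (Conf M) ℝ ℂ Complex.ofRealCLM).comp
    (innerSL ℝ : Conf M →L[ℝ] Conf M →L[ℝ] ℝ)

theorem fderiv_gauss_ofReal :
    fderiv ℝ (fun x : Conf M => (gauss M x : ℂ)) =
      fun x => (gauss M x : ℂ) • gaussLog M x := by
  funext x
  have h1 : HasFDerivAt (fun y : Conf M => ‖y‖ ^ 2) (2 • innerSL ℝ x) x :=
    (hasStrictFDerivAt_norm_sq x).hasFDerivAt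
  have h2 : HasFDerivAt (fun y : Conf M => -(‖y‖ ^ 2 / 4)) (-((4 : ℝ)⁻¹ • (2 • innerSL ℝ x))) x := by
    have := (h1.const_mul (4 : ℝ)⁻¹).neg
    refine this.congr_of_eventuallyEq (Filter.Eventually.of_forall fun y => ?_)
    simp [div_eq_inv_mul]
  have h3 : HasFDerivAt (gauss M) _ x := (h2.exp).const_mul ((2 * Real.pi) ^ (-(M : ℝ) / 4))
  have h4 : HasFDerivAt (fun x : Conf M => (gauss M x : ℂ)) _ x :=
    Complex.ofRealCLM.hasFDerivAt.comp x h3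
  rw [h4.fderiv]
  ext v
  simp [gaussLog, gauss]
  ring

/-- All derivatives of the Gaussian decay rapidly: each further derivative is, by the Leibniz rule, a
sum of earlier ones with coefficients of temperate growth. -/
theorem gauss_decay (n k : ℕ) :
    ∃ C : ℝ, ∀ x : Conf M,
      (1 + ‖x‖) ^ k * ‖iteratedFDeriv ℝ n (fun x : Conf M => (gauss M x : ℂ)) x‖ ≤ C := by
  induction n using Nat.strong_induction_on generalizing k with
  | _ n ih =>
  rcases n with _ | n
  · refine ⟨2 ^ k * k.factorial * Real.exp 1 * (2 * Real.pi) ^ (-(M : ℝ) / 4), fun x => ?_⟩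
    rw [norm_iteratedFDeriv_zero, Complex.norm_real, Real.norm_of_nonneg (gauss_pos x).le, gauss]
    have h1 : (1 + ‖x‖) ^ k ≤ (2 * (1 + ‖x‖ ^ 2 / 4)) ^ k := by
      gcongr
      nlinarith [sq_nonneg (‖x‖ - 1)]
    have h2 := Real.pow_div_factorial_le_exp (1 + ‖x‖ ^ 2 / 4) (by positivity) k
    rw [div_le_iff₀ (by positivity)] at h2
    have h3 : (1 + ‖x‖) ^ k ≤ 2 ^ k * (Real.exp (1 + ‖x‖ ^ 2 / 4) * k.factorial) := by
      refine h1.trans ?_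
      rw [mul_pow]
      gcongr
    calc (1 + ‖x‖) ^ k * ((2 * Real.pi) ^ (-(M : ℝ) / 4) * Real.exp (-(‖x‖ ^ 2 / 4)))
        ≤ (2 ^ k * (Real.exp (1 + ‖x‖ ^ 2 / 4) * k.factorial)) *
          ((2 * Real.pi) ^ (-(M : ℝ) / 4) * Real.exp (-(‖x‖ ^ 2 / 4))) := by gcongr
      _ = _ := by
        rw [Real.exp_add, Real.exp_neg]
        field_simp
  · obtain ⟨m, D, hD, hA⟩ :=
      ((gaussLog M).hasTemperateGrowth).norm_iteratedFDeriv_le_uniform n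
    choose C hC using fun i : Fin (n + 1) => ih i i.2 (k + m)
    refine ⟨∑ i : Fin (n + 1), (n.choose i : ℝ) * C i * D, fun x => ?_⟩
    rw [← norm_iteratedFDeriv_fderiv, fderiv_gauss_ofReal]
    have h := norm_iteratedFDeriv_smul_le (n := n) (gauss_ofReal_contDiff (M := M))
      ((gaussLog M).contDiff (n := (⊤ : ℕ∞))) x (by exact_mod_cast le_top)
    rw [← Fin.sum_univ_eq_sum_range (fun i => (n.choose i : ℝ) *
      ‖iteratedFDeriv ℝ i (fun x : Conf M => (gauss M x : ℂ)) x‖ *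
        ‖iteratedFDeriv ℝ (n - i) (gaussLog M) x‖)] at h
    refine (mul_le_mul_of_nonneg_left h (by positivity)).trans ?_
    rw [Finset.mul_sum]
    refine Finset.sum_le_sum fun i _ => ?_
    have h1 := hA (n - i) (Nat.sub_le _ _) x
    have h2 := hC i x
    calc (1 + ‖x‖) ^ k * ((n.choose i : ℝ) *
          ‖iteratedFDeriv ℝ i (fun x : Conf M => (gauss M x : ℂ)) x‖ *
          ‖iteratedFDeriv ℝ (n - i) (gaussLog M) x‖)
        ≤ (1 + ‖x‖) ^ k * ((n.choose i : ℝ) *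
          ‖iteratedFDeriv ℝ i (fun x : Conf M => (gauss M x : ℂ)) x‖ *
          (D * (1 + ‖x‖) ^ m)) := by gcongr
      _ = (n.choose i : ℝ) * ((1 + ‖x‖) ^ (k + m) *
          ‖iteratedFDeriv ℝ i (fun x : Conf M => (gauss M x : ℂ)) x‖) * D := by
        rw [pow_add]; ring
      _ ≤ _ := by gcongr

/-- The vacuum as a Schwartz function. -/
def vacS (M : ℕ) : Core M where
  toFun x := (gauss M x : ℂ)
  smooth' := gauss_ofReal_contDiff
  decay' k n := by
    obtain ⟨C, hC⟩ := gauss_decay (M := M) n k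
    refine ⟨C, fun x => (mul_le_mul_of_nonneg_right ?_ (norm_nonneg _)).trans (hC x)⟩
    gcongr
    linarith

theorem vacS_apply (x : Conf M) : vacS M x = (gauss M x : ℂ) := rfl

theorem annih_vacS (n : Fin M) : annih n (vacS M) = 0 := by
  ext x
  rw [annih_eq, add_apply, halfPos_apply, partialD_apply]
  change _ * (gauss M x : ℂ) + fderiv ℝ (fun x : Conf M => (gauss M x : ℂ)) x _ = 0
  rw [fderiv_gauss_ofReal]
  simp [gaussLog, EuclideanSpace.inner_single_right]
  ring

/-! ### The number states -/

theorem commute_powersHom_creat : Pairwise fun m n : Fin M => ∀ x y : Multiplicative ℕ,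
    Commute (powersHom (Core M →L[ℂ] Core M) (creat m) x)
      (powersHom (Core M →L[ℂ] Core M) (creat n) y) := fun m n _ x y => by
  have h : Commute (creat m) (creat n) := ContinuousLinearMap.ext (creat_comm m n)
  simpa [powersHom_apply] using h.pow_pow _ _

/-- The product `∏ n, (a† n) ^ (k n)` of powers of the (commuting) creation operators. -/
def creatPow (k : Fin M → ℕ) : Core M →L[ℂ] Core M :=
  MonoidHom.noncommPiCoprod (fun n => powersHom (Core M →L[ℂ] Core M) (creat n))
    commute_powersHom_creat (fun n => Multiplicative.ofAdd (k n))

theorem creatPow_zero : creatPow (0 : Fin M → ℕ) = 1 :=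
  map_one (MonoidHom.noncommPiCoprod _ _)

theorem creatPow_add (k l : Fin M → ℕ) : creatPow (k + l) = creatPow k * creatPow l :=
  map_mul (MonoidHom.noncommPiCoprod _ _) _ _

theorem creatPow_single (n : Fin M) : creatPow (Pi.single n 1) = creat n := by
  have h : (fun m => Multiplicative.ofAdd ((Pi.single n 1 : Fin M → ℕ) m)) =
      Pi.mulSingle (M := fun _ : Fin M => Multiplicative ℕ) n (Multiplicative.ofAdd 1) := by
    ext m
    by_cases h : m = n
    · subst h; simp
    · simp [h]
  rw [creatPow, h, MonoidHom.noncommPiCoprod_mulSingle]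
  simp [powersHom_apply]

theorem creat_creatPow (n : Fin M) (k : Fin M → ℕ) (φ : Core M) :
    creat n (creatPow k φ) = creatPow (Pi.single n 1 + k) φ := by
  rw [creatPow_add, creatPow_single]; rfl

/-- Induction on occupation numbers: a property of `0` and the unit vectors that is stable under
addition holds for all of `Fin M → ℕ`. -/
theorem occupation_induction {P : (Fin M → ℕ) → Prop} (h0 : P 0)
    (h1 : ∀ n, P (Pi.single n 1)) (h2 : ∀ k l, P k → P l → P (k + l)) (k : Fin M → ℕ) : P k := by
  let S : AddSubmonoid (Fin M → ℕ) :=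
    { carrier := {k | P k}, zero_mem' := h0, add_mem' := fun {a b} ha hb => h2 a b ha hb }
  change k ∈ S
  have hk : k = ∑ n, k n • Pi.single n (1 : ℕ) := by
    ext m
    simp [Finset.sum_apply, Pi.single_apply]
  rw [hk]
  exact sum_mem fun n _ => nsmul_mem (show Pi.single n 1 ∈ S from h1 n) _

theorem creatPow_injective (k : Fin M → ℕ) : Function.Injective (creatPow k) := by
  induction k using occupation_induction with
  | h0 => rw [creatPow_zero]; exact Function.injective_id
  | h1 n => rw [creatPow_single]; exact creat_injective n
  | h2 k l hk hl => rw [creatPow_add]; exact hk.comp hl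

/-- `a† n a n` counts the excitations of mode `n`: `[a† n a n, ∏ (a† m) ^ k m] = k n ∏ (a† m) ^ k m`. -/
theorem number_creatPow (n : Fin M) (k : Fin M → ℕ) (φ : Core M) :
    creat n (annih n (creatPow k φ)) =
      creatPow k (creat n (annih n φ)) + (k n : ℂ) • creatPow k φ := by
  induction k using occupation_induction generalizing φ with
  | h0 => simp [creatPow_zero]
  | h1 m =>
    rw [creatPow_single, annih_creat, map_add, creat_comm]
    by_cases h : n = m
    · subst h; simp
    · simp [h]
  | h2 k l hk hl =>
    rw [creatPow_add]
    change creat n (annih n (creatPow k (creatPow l φ))) = creatPow k (creatPow l _) +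
      _ • creatPow k (creatPow l φ)
    rw [hk, hl, map_add, map_smul]
    simp only [Pi.add_apply, Nat.cast_add]
    module

/-- The (unnormalized) number state with occupation numbers `k`, a Hermite function. -/
def numState (k : Fin M → ℕ) : Core M := creatPow k (vacS M)

theorem number_numState (n : Fin M) (k : Fin M → ℕ) :
    creat n (annih n (numState k)) = (k n : ℂ) • numState k := by
  rw [numState, number_creatPow, annih_vacS]
  simp

theorem numState_zero : numState (0 : Fin M → ℕ) = vacS M := by
  rw [numState, creatPow_zero]; rfl

theorem numState_ne_zero (k : Fin M → ℕ) : numState k ≠ 0 := by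
  intro h
  have h1 : vacS M = 0 := creatPow_injective k (h.trans (map_zero _).symm)
  have h2 : vacS M 0 = 0 := by rw [h1]; rfl
  rw [vacS_apply] at h2
  exact (gauss_pos (0 : Conf M)).ne' (by exact_mod_cast h2)

theorem inner_number (n : Fin M) (φ η : Core M) :
    inner ℂ (incl (creat n (annih n φ))) (incl η) =
      inner ℂ (incl φ) (incl (creat n (annih n η))) := by
  rw [inner_creat, inner_annih]

theorem inner_numState_of_ne {k l : Fin M → ℕ} (h : k ≠ l) :
    inner ℂ (incl (numState k)) (incl (numState l)) = 0 := by
  obtain ⟨n, hn⟩ := Function.ne_iff.1 h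
  have h1 := inner_number n (numState k) (numState l)
  rw [number_numState, number_numState, incl_smul, incl_smul, inner_smul_left, inner_smul_right,
    Complex.conj_natCast] at h1
  have h2 : ((k n : ℂ) - l n) * inner ℂ (incl (numState k)) (incl (numState l)) = 0 := by
    rw [sub_mul, h1, sub_self]
  refine (mul_eq_zero.1 h2).resolve_left (sub_ne_zero.2 ?_)
  exact_mod_cast hn

/-- The span of the number states is stable under multiplication by coordinates. -/
theorem halfPos_mem_span {φ : Core M} (n : Fin M)
    (hφ : φ ∈ Submodule.span ℂ (Set.range (numState (M := M)))) :
    halfPos n φ ∈ Submodule.span ℂ (Set.range (numState (M := M))) := by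
  set S := Submodule.span ℂ (Set.range (numState (M := M)))
  suffices h : S ≤ S.comap (halfPos n).toLinearMap from h hφ
  refine Submodule.span_le.2 ?_
  rintro _ ⟨k, rfl⟩
  have hmem : ∀ l, numState (M := M) l ∈ S := fun l => Submodule.subset_span ⟨l, rfl⟩
  have hc : ∀ l, creat n (numState l) = numState (Pi.single n 1 + l) := fun l =>
    creat_creatPow n l (vacS M)
  change halfPos n (numState k) ∈ S
  rw [halfPos_eq]
  refine S.smul_mem _ (S.add_mem ?_ (hc k ▸ hmem _))
  rcases hk : k n with _ | j
  · have h1 : ((‖incl (annih n (numState k))‖ : ℝ) : ℂ) ^ 2 = 0 := by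
      rw [ofReal_norm_sq, inner_annih, number_numState, hk]
      simp [incl_zero]
    have h2 : incl (annih n (numState k)) = 0 := by simpa using h1
    rw [incl_injective (h2.trans incl_zero.symm)]
    exact S.zero_mem
  · have h1 : k = Pi.single n 1 + Function.update k n j := by
      ext m
      by_cases h : m = n
      · subst h; simp [hk, add_comm]
      · simp [h]
    rw [h1, ← hc, annih_creat, number_numState]
    exact S.add_mem (S.smul_mem _ (hmem _)) (S.smul_mem _ (hmem _))

/-! ### Completeness of the number states -/

/-- An integrable function with vanishing Fourier transform vanishes almost everywhere. -/
theorem ae_eq_zero_of_fourier_eq_zero {u : Conf M → ℂ} (hu : Integrable u)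
    (h : ∀ ξ, 𝓕 u ξ = 0) : ∀ᵐ x, u x = 0 := by
  refine ae_eq_zero_of_integral_contDiff_smul_eq_zero hu.locallyIntegrable fun g hg hc => ?_
  have hg₁ : HasCompactSupport (Complex.ofRealCLM ∘ g) := hc.comp_left rfl
  have hg₂ : ContDiff ℝ (⊤ : ℕ∞) (Complex.ofRealCLM ∘ g) := by fun_prop
  set G : Core M := hg₁.toSchwartzMap hg₂
  have h0 : ∀ η : Core M, ∫ ξ, (𝓕 η : Core M) ξ • u ξ = ∫ x, η x • 𝓕 u x := fun η => by
    simpa using! VectorFourier.integral_fourierIntegral_smul_eq_flip (L := innerₗ (Conf M))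
      Real.continuous_fourierChar continuous_inner (η.integrable (μ := volume)) hu
  have h1 := h0 (𝓕⁻ G)
  rw [FourierTransform.fourier_fourierInv_eq] at h1
  simp only [h, smul_zero, integral_zero] at h1
  rw [← h1]
  congr 1

theorem exp_mul_gauss_memLp (c : ℝ) :
    MemLp (fun x : Conf M => Real.exp (c * ‖x‖) * gauss M x) 2 volume := by
  have hcont : Continuous (fun x : Conf M => Real.exp (c * ‖x‖) * gauss M x) := by
    unfold gauss; fun_prop
  rw [memLp_two_iff_integrable_sq_norm hcont.aestronglyMeasurable]
  have h := (GaussianFourier.integrable_cexp_neg_mul_sq_norm_add (V := Conf M) (b := 1 / 4)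
    (by norm_num) 0 0).norm
  refine (h.const_mul (((2 * Real.pi) ^ (-(M : ℝ) / 4)) ^ 2 * Real.exp (4 * c ^ 2))).mono
    (hcont.norm.pow 2).aestronglyMeasurable (Filter.Eventually.of_forall fun x => ?_)
  have e1 : ‖Complex.exp (-(1 / 4) * (‖x‖ : ℂ) ^ 2 + 0 * (inner ℝ (0 : Conf M) x : ℝ))‖ =
      Real.exp (-(1 / 4) * ‖x‖ ^ 2) := by
    rw [Complex.norm_exp]
    congr 1
    simp [← Complex.ofReal_pow]
  rw [e1, norm_pow, norm_norm, Real.norm_of_nonneg (mul_nonneg (Real.exp_pos _).le (gauss_pos x).le),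
    Real.norm_of_nonneg (by positivity), gauss]
  calc (Real.exp (c * ‖x‖) * ((2 * Real.pi) ^ (-(M : ℝ) / 4) * Real.exp (-(‖x‖ ^ 2 / 4)))) ^ 2
      = ((2 * Real.pi) ^ (-(M : ℝ) / 4)) ^ 2 * Real.exp (2 * (c * ‖x‖) - ‖x‖ ^ 2 / 2) := by
        rw [mul_pow, mul_pow, ← Real.exp_nat_mul, ← Real.exp_nat_mul, mul_left_comm, ← Real.exp_add]
        congr 2
        push_cast
        ring
    _ ≤ ((2 * Real.pi) ^ (-(M : ℝ) / 4)) ^ 2 * Real.exp (4 * c ^ 2 + -(1 / 4) * ‖x‖ ^ 2) := by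
        gcongr
        nlinarith [sq_nonneg (2 * c - ‖x‖ / 2)]
    _ = _ := by rw [Real.exp_add]; ring

theorem inner_incl_left (φ : Core M) (f : Hilb M) :
    inner ℂ (incl φ) f = ∫ x, conj (φ x) * f x := by
  rw [L2.inner_def]
  refine integral_congr_ae ?_
  filter_upwards [φ.coeFn_toLp 2 volume] with x hx
  rw [incl, hx, RCLike.inner_apply, mul_comm]

theorem sum_halfPos_apply (ξ : Conf M) (φ : Core M) (x : Conf M) :
    (∑ n, ((2 * ξ n : ℝ) : ℂ) • halfPos n φ) x = (⟪x, ξ⟫ : ℂ) * φ x := by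
  rw [sum_apply, PiLp.inner_apply, Complex.ofReal_sum, Finset.sum_mul]
  refine Finset.sum_congr rfl fun n _ => ?_
  rw [smul_apply, halfPos_apply]
  simp
  ring

theorem exists_pow_mul_vacS (ξ : Conf M) (j : ℕ) :
    ∃ φ ∈ Submodule.span ℂ (Set.range (numState (M := M))),
      ∀ x, φ x = (⟪x, ξ⟫ : ℂ) ^ j * (gauss M x : ℂ) := by
  induction j with
  | zero =>
    refine ⟨vacS M, ?_, fun x => by simp [vacS_apply]⟩
    rw [← numState_zero]
    exact Submodule.subset_span ⟨_, rfl⟩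
  | succ j ih =>
    obtain ⟨φ, hφ, h⟩ := ih
    refine ⟨∑ n, ((2 * ξ n : ℝ) : ℂ) • halfPos n φ,
      Submodule.sum_mem _ fun n _ => Submodule.smul_mem _ _ (halfPos_mem_span n hφ), fun x => ?_⟩
    rw [sum_halfPos_apply, h]
    ring

/-- The number states are complete. If `f` is orthogonal to all of them, it is orthogonal to all
polynomials times the Gaussian; expanding the exponential, the Fourier transform of `gauss * f`
vanishes. -/
theorem eq_zero_of_inner_numState {f : Hilb M}
    (hf : ∀ k, inner ℂ (incl (numState k)) f = 0) : f = 0 := by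
  have hspan : ∀ φ ∈ Submodule.span ℂ (Set.range (numState (M := M))),
      inner ℂ (incl φ) f = 0 := by
    intro φ hφ
    induction hφ using Submodule.span_induction with
    | mem x hx => obtain ⟨k, rfl⟩ := hx; exact hf k
    | zero => rw [incl_zero, inner_zero_left]
    | add x y _ _ hx hy => rw [incl_add, inner_add_left, hx, hy, add_zero]
    | smul a x _ hx => rw [incl_smul, inner_smul_left, hx, mul_zero]
  have hmom : ∀ (ξ : Conf M) (j : ℕ), ∫ x, (⟪x, ξ⟫ : ℂ) ^ j * ((gauss M x : ℂ) * f x) = 0 := by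
    intro ξ j
    obtain ⟨φ, hφ, h⟩ := exists_pow_mul_vacS ξ j
    rw [← hspan φ hφ, inner_incl_left]
    congr 1
    ext x
    rw [h, map_mul, map_pow, Complex.conj_ofReal, Complex.conj_ofReal]
    ring
  have hexp : ∀ c : ℝ, Integrable (fun x => Real.exp (c * ‖x‖) * gauss M x * ‖f x‖) := fun c =>
    (exp_mul_gauss_memLp c).integrable_mul (Lp.memLp f).norm
  have hmeas : AEStronglyMeasurable (fun x => (gauss M x : ℂ) * f x) volume :=
    (gauss_ofReal_contDiff.continuous.aestronglyMeasurable).mul (Lp.memLp f).1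
  have hint : Integrable (fun x => (gauss M x : ℂ) * f x) := by
    refine (hexp 0).mono hmeas (Filter.Eventually.of_forall fun x => ?_)
    simp
  have hF : ∀ ξ, 𝓕 (fun x => (gauss M x : ℂ) * f x) ξ = 0 := by
    intro ξ
    have hs := hasSum_integral_of_dominated_convergence (μ := (volume : Measure (Conf M)))
      (F := fun (j : ℕ) x => ((-2 * Real.pi * Complex.I) ^ j / (j.factorial : ℂ)) *
        ((⟪x, ξ⟫ : ℂ) ^ j * ((gauss M x : ℂ) * f x)))
      (f := fun x => Complex.exp (-2 * Real.pi * Complex.I * (⟪x, ξ⟫ : ℂ)) *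
        ((gauss M x : ℂ) * f x))
      (fun j x => (2 * Real.pi * ‖ξ‖ * ‖x‖) ^ j / (j.factorial : ℝ) * (gauss M x * ‖f x‖))
      ?_ ?_ ?_ ?_ ?_
    · simp only [integral_const_mul, hmom, mul_zero] at hs
      rw [Real.fourier_eq', ← hs.unique hasSum_zero]
      congr 1
      ext x
      rw [smul_eq_mul]
      congr 2
      push_cast
      ring
    · intro j
      refine (Continuous.aestronglyMeasurable ?_).mul
        ((Continuous.aestronglyMeasurable ?_).mul hmeas)
      · fun_prop
      · fun_prop
    · intro j
      refine Filter.Eventually.of_forall fun x => ?_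
      have h1 : ‖(⟪x, ξ⟫ : ℂ)‖ ≤ ‖x‖ * ‖ξ‖ := by
        rw [Complex.norm_real]; exact norm_inner_le_norm x ξ
      have h2 : ‖(-2 * Real.pi * Complex.I : ℂ)‖ = 2 * Real.pi := by
        simp [abs_of_pos Real.pi_pos]
      rw [norm_mul, norm_div, norm_pow, h2, norm_mul, norm_pow, norm_mul,
        Complex.norm_natCast, Complex.norm_real (gauss M x), Real.norm_of_nonneg (gauss_pos x).le]
      calc (2 * Real.pi) ^ j / (j.factorial : ℝ) * (‖(⟪x, ξ⟫ : ℂ)‖ ^ j * (gauss M x * ‖f x‖))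
          ≤ (2 * Real.pi) ^ j / (j.factorial : ℝ) * ((‖x‖ * ‖ξ‖) ^ j * (gauss M x * ‖f x‖)) := by
            have := (gauss_pos x).le
            gcongr
        _ = _ := by ring
    · exact Filter.Eventually.of_forall fun x =>
        (Real.summable_pow_div_factorial _).mul_right _
    · refine (hexp (2 * Real.pi * ‖ξ‖)).congr
        (Filter.Eventually.of_forall fun x => ?_)
      simp only
      rw [tsum_mul_right, Real.exp_eq_exp_ℝ, NormedSpace.exp_eq_tsum_div, mul_assoc]
    · refine Filter.Eventually.of_forall fun x => ?_
      have h := (NormedSpace.exp_series_hasSum_exp' (𝕂 := ℂ)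
        (-2 * Real.pi * Complex.I * (⟪x, ξ⟫ : ℂ))).mul_right ((gauss M x : ℂ) * f x)
      rw [← Complex.exp_eq_exp_ℂ] at h
      refine h.congr_fun ?_
      intro j
      rw [smul_eq_mul, mul_pow]
      ring
  have h0 := ae_eq_zero_of_fourier_eq_zero hint hF
  refine (Lp.eq_zero_iff_ae_eq_zero).2 ?_
  filter_upwards [h0] with x hx
  exact (mul_eq_zero.1 hx).resolve_left (by exact_mod_cast (gauss_pos x).ne')

/-- The normalized number states are orthonormal. -/
theorem orthonormal_numState :
    Orthonormal ℂ (fun k : Fin M → ℕ => ((‖incl (numState k)‖⁻¹ : ℝ) : ℂ) • incl (numState k)) := by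
  refine ⟨fun k => ?_, fun k l h => ?_⟩
  · have h : ‖incl (numState k)‖ ≠ 0 := fun h =>
      numState_ne_zero k (incl_injective ((norm_eq_zero.1 h).trans incl_zero.symm))
    rw [norm_smul, Complex.norm_real, norm_inv, norm_norm, inv_mul_cancel₀ h]
  · simp only [inner_smul_left, inner_smul_right, inner_numState_of_ne h, mul_zero]

/-- The Hilbert basis of normalized number states (Hermite functions). -/
def numBasis (M : ℕ) : HilbertBasis (Fin M → ℕ) ℂ (Hilb M) :=
  HilbertBasis.mkOfOrthogonalEqBot orthonormal_numState (by
    refine (Submodule.eq_bot_iff _).2 fun f hf => eq_zero_of_inner_numState fun k => ?_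
    have h1 := (Submodule.mem_orthogonal _ _).1 hf _ (Submodule.subset_span ⟨k, rfl⟩)
    have h : ‖incl (numState k)‖ ≠ 0 := fun h =>
      numState_ne_zero k (incl_injective ((norm_eq_zero.1 h).trans incl_zero.symm))
    rw [inner_smul_left] at h1
    exact (mul_eq_zero.1 h1).resolve_left (by simpa using h))

theorem numBasis_apply (k : Fin M → ℕ) :
    numBasis M k = incl (((‖incl (numState k)‖⁻¹ : ℝ) : ℂ) • numState k) := by
  rw [numBasis, HilbertBasis.coe_mkOfOrthogonalEqBot, incl_smul]

/-! ### Bounded perturbations of a diagonal operator with discrete spectrum -/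

section Abstract

variable {ι H : Type*} [NormedAddCommGroup H] [InnerProductSpace ℂ H]

/-- `χ` is the image of `ψ` under `D + B`, where `D` is diagonal in the Hilbert basis `b` with
eigenvalues `ν` and has its maximal domain. -/
def IsDiagImage (b : HilbertBasis ι ℂ H) (ν : ι → ℝ) (B : H →L[ℂ] H) (ψ χ : H) : Prop :=
  ∀ k, (ν k : ℂ) * inner ℂ (b k) ψ + inner ℂ (b k) (B ψ) = inner ℂ (b k) χ

/-- The weights `ν k * ‖c k‖ ^ 2`, whose sum is the quadratic form of the diagonal operator. -/
def diagTerm (b : HilbertBasis ι ℂ H) (ν : ι → ℝ) (ψ : H) (k : ι) : ℝ :=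
  ν k * ‖inner ℂ (b k) ψ‖ ^ 2

/-- The quadratic form of the diagonal operator with values in `[0, ∞]`. -/
def diagForm (b : HilbertBasis ι ℂ H) (ν : ι → ℝ) (ψ : H) : ℝ≥0∞ :=
  ∑' k, ENNReal.ofReal (diagTerm b ν ψ k)

/-- The quadratic form of `D + B`; a junk value unless `diagTerm b ν ψ` is summable. -/
def totalForm (b : HilbertBasis ι ℂ H) (ν : ι → ℝ) (B : H →L[ℂ] H) (ψ : H) : ℝ :=
  ∑' k, diagTerm b ν ψ k + (inner ℂ ψ (B ψ)).re

variable {b : HilbertBasis ι ℂ H} {ν : ι → ℝ} {B : H →L[ℂ] H}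

theorem diagTerm_nonneg (hν : ∀ k, 0 ≤ ν k) (ψ : H) (k : ι) : 0 ≤ diagTerm b ν ψ k :=
  mul_nonneg (hν k) (sq_nonneg _)

theorem diagForm_eq_ofReal (hν : ∀ k, 0 ≤ ν k) {ψ : H} (h : Summable (diagTerm b ν ψ)) :
    diagForm b ν ψ = ENNReal.ofReal (∑' k, diagTerm b ν ψ k) :=
  (ENNReal.ofReal_tsum_of_nonneg (diagTerm_nonneg hν ψ) h).symm

theorem summable_diagTerm (hν : ∀ k, 0 ≤ ν k) {ψ : H} (h : diagForm b ν ψ ≠ ∞) :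
    Summable (diagTerm b ν ψ) := by
  refine (ENNReal.summable_toReal h).congr fun k => ?_
  rw [ENNReal.toReal_ofReal (diagTerm_nonneg hν ψ k)]

theorem lowerSemicontinuous_diagForm : LowerSemicontinuous (diagForm b ν) := by
  refine lowerSemicontinuous_tsum fun k => Continuous.lowerSemicontinuous ?_
  unfold diagTerm
  exact ENNReal.continuous_ofReal.comp (by fun_prop)

theorem hasSum_norm_sq (b : HilbertBasis ι ℂ H) (ψ : H) :
    HasSum (fun k => ‖inner ℂ (b k) ψ‖ ^ 2) (‖ψ‖ ^ 2) := by
  have h := Complex.hasSum_re (b.hasSum_inner_mul_inner ψ ψ)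
  rw [inner_self_eq_norm_sq_to_K] at h
  convert! h using 1
  · ext k
    rw [← inner_conj_symm ψ (b k), ← Complex.normSq_eq_conj_mul_self, Complex.normSq_eq_norm_sq,
      Complex.ofReal_re]
  · norm_cast

/-- Sets of bounded energy are compact because the eigenvalues tend to infinity. -/
theorem isCompact_diagForm_le [CompleteSpace H] (hν : ∀ k, 0 ≤ ν k) (hfin : ∀ c : ℝ, {k | ν k ≤ c}.Finite)
    (C : ℝ) : IsCompact {ψ : H | ‖ψ‖ = 1 ∧ diagForm b ν ψ ≤ ENNReal.ofReal C} := by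
  classical
  refine isCompact_iff_totallyBounded_isComplete.2 ⟨?_, IsClosed.isComplete ?_⟩
  · refine Metric.totallyBounded_iff.2 fun ε hε => ?_
    set F : Finset ι := (hfin ((|C| + 1) / (ε / 2) ^ 2)).toFinset
    let P : (F → ℂ) → H := fun c => ∑ k : F, c k • b k
    have hP : Continuous P := by fun_prop
    have hc : TotallyBounded (P '' Metric.closedBall 0 1) :=
      ((isCompact_closedBall (0 : F → ℂ) 1).image hP).totallyBounded
    obtain ⟨t, ht, htc⟩ := Metric.totallyBounded_iff.1 hc (ε / 2) (half_pos hε)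
    refine ⟨t, ht, fun ψ hψ => ?_⟩
    obtain ⟨h1, h2⟩ := hψ
    have hs : Summable (diagTerm b ν ψ) := summable_diagTerm hν (ne_top_of_le_ne_top (by simp) h2)
    rw [diagForm_eq_ofReal hν hs] at h2
    have h3 : ∑' k, diagTerm b ν ψ k ≤ |C| := by
      have := ENNReal.toReal_mono (by simp) h2
      rw [ENNReal.toReal_ofReal (tsum_nonneg (diagTerm_nonneg hν ψ)), ENNReal.toReal_ofReal'] at this
      exact this.trans (max_le (le_abs_self C) (abs_nonneg C))
    set c : F → ℂ := fun k => inner ℂ (b k) ψ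
    have hcmem : c ∈ Metric.closedBall (0 : F → ℂ) 1 := by
      rw [mem_closedBall_zero_iff, pi_norm_le_iff_of_nonneg zero_le_one]
      intro k
      refine (norm_inner_le_norm _ _).trans ?_
      rw [b.orthonormal.1, h1, one_mul]
    have hcoef : ∀ k, inner ℂ (b k) (ψ - P c) = if k ∈ F then 0 else inner ℂ (b k) ψ := by
      intro k
      have hPk : P c = ∑ j ∈ F, (inner ℂ (b j) ψ) • b j :=
        Finset.sum_coe_sort F (fun j => (inner ℂ (b j) ψ : ℂ) • b j)
      rw [inner_sub_right, hPk, inner_sum]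
      simp only [inner_smul_right]
      by_cases hk : k ∈ F
      · rw [if_pos hk, Finset.sum_eq_single k]
        · rw [inner_self_eq_norm_sq_to_K, b.orthonormal.1]; simp
        · intro j _ hj
          rw [b.orthonormal.2 (Ne.symm hj), mul_zero]
        · exact fun h => absurd hk h
      · rw [if_neg hk, Finset.sum_eq_zero, sub_zero]
        intro j hj
        rw [b.orthonormal.2 (fun h => hk (by rw [h]; exact hj)), mul_zero]
    have hdist : ‖ψ - P c‖ < ε / 2 := by
      have e1 := hasSum_norm_sq b (ψ - P c)
      have e2 : ‖ψ - P c‖ ^ 2 ≤ (ε / 2) ^ 2 / (|C| + 1) * ∑' k, diagTerm b ν ψ k := by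
        refine hasSum_le (fun k => ?_) e1 (hs.hasSum.mul_left _)
        rw [hcoef]
        by_cases hk : k ∈ F
        · rw [if_pos hk, norm_zero, zero_pow two_ne_zero]
          exact mul_nonneg (by positivity) (diagTerm_nonneg hν ψ k)
        · rw [if_neg hk, diagTerm, ← mul_assoc]
          refine le_mul_of_one_le_left (sq_nonneg _) ?_
          have : (|C| + 1) / (ε / 2) ^ 2 < ν k := by simpa [F] using hk
          rw [div_lt_iff₀ (by positivity)] at this
          rw [div_mul_eq_mul_div, one_le_div (by positivity)]
          linarith
      have e3 : ‖ψ - P c‖ ^ 2 < (ε / 2) ^ 2 := by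
        refine e2.trans_lt ?_
        have : (0 : ℝ) < |C| + 1 := by positivity
        rw [div_mul_eq_mul_div, div_lt_iff₀ this]
        have : 0 < (ε / 2) ^ 2 := by positivity
        nlinarith
      exact lt_of_pow_lt_pow_left₀ 2 (by positivity) e3
    have := htc ⟨c, hcmem, rfl⟩
    simp only [Set.mem_iUnion, Metric.mem_ball] at this ⊢
    obtain ⟨y, hy, hd⟩ := this
    refine ⟨y, hy, ?_⟩
    calc dist ψ y ≤ dist ψ (P c) + dist (P c) y := dist_triangle _ _ _
      _ < ε / 2 + ε / 2 := add_lt_add (by rwa [dist_eq_norm]) hd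
      _ = ε := add_halves ε
  · exact (isClosed_eq continuous_norm continuous_const).inter
      (lowerSemicontinuous_diagForm.isClosed_preimage _)

theorem re_inner_apply_ge (B : H →L[ℂ] H) (ψ : H) : -(‖B‖ * ‖ψ‖ ^ 2) ≤ (inner ℂ ψ (B ψ)).re := by
  have h1 := Complex.abs_re_le_norm (inner ℂ ψ (B ψ))
  have h2 := norm_inner_le_norm (𝕜 := ℂ) ψ (B ψ)
  have h3 := mul_le_mul_of_nonneg_left (B.le_opNorm ψ) (norm_nonneg ψ)
  have h4 := neg_abs_le (inner ℂ ψ (B ψ)).re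
  nlinarith

/-- The quadratic form of `D + B` attains its minimum on the unit sphere. -/
theorem exists_unit_minimizer [CompleteSpace H] [Nonempty ι] (b : HilbertBasis ι ℂ H) (hν : ∀ k, 0 ≤ ν k)
    (hfin : ∀ c : ℝ, {k | ν k ≤ c}.Finite) (B : H →L[ℂ] H) :
    ∃ ψ₀ : H, ‖ψ₀‖ = 1 ∧ Summable (diagTerm b ν ψ₀) ∧
      ∀ φ : H, ‖φ‖ = 1 → Summable (diagTerm b ν φ) → totalForm b ν B ψ₀ ≤ totalForm b ν B φ := by
  classical
  -- The shift by `‖B‖` makes both summands nonnegative, so that the form can be `ℝ≥0∞`-valued.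
  set Q : H → ℝ≥0∞ := fun ψ =>
    diagForm b ν ψ + ENNReal.ofReal ((inner ℂ ψ (B ψ)).re + ‖B‖) with hQ
  have hlsc : LowerSemicontinuous Q :=
    lowerSemicontinuous_diagForm.add (Continuous.lowerSemicontinuous
      (ENNReal.continuous_ofReal.comp (by fun_prop)))
  have hQr : ∀ ψ : H, ‖ψ‖ = 1 → Summable (diagTerm b ν ψ) →
      Q ψ = ENNReal.ofReal (totalForm b ν B ψ + ‖B‖) := by
    intro ψ h1 hs
    have := re_inner_apply_ge B ψ
    rw [h1] at this
    simp only [hQ]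
    rw [diagForm_eq_ofReal hν hs, ← ENNReal.ofReal_add (tsum_nonneg (diagTerm_nonneg hν ψ))
      (by linarith), totalForm, add_assoc]
  have hnn : ∀ ψ : H, ‖ψ‖ = 1 → Summable (diagTerm b ν ψ) → 0 ≤ totalForm b ν B ψ + ‖B‖ := by
    intro ψ h1 hs
    have h2 := re_inner_apply_ge B ψ
    have h3 : 0 ≤ ∑' k, diagTerm b ν ψ k := tsum_nonneg (diagTerm_nonneg hν ψ)
    rw [h1] at h2
    unfold totalForm
    linarith
  obtain ⟨k₀⟩ := ‹Nonempty ι›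
  have hb0 : ‖b k₀‖ = 1 := b.orthonormal.1 k₀
  have hsb : Summable (diagTerm b ν (b k₀)) := by
    refine summable_of_ne_finset_zero (s := {k₀}) fun k hk => ?_
    rw [diagTerm, b.orthonormal.2 (by simpa using hk)]
    simp
  set C := totalForm b ν B (b k₀) + ‖B‖
  have hle : ∀ φ : H, Q φ ≤ ENNReal.ofReal C → diagForm b ν φ ≤ ENNReal.ofReal C := fun φ h =>
    le_self_add.trans h
  have hmem : b k₀ ∈ {ψ : H | ‖ψ‖ = 1 ∧ diagForm b ν ψ ≤ ENNReal.ofReal C} :=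
    ⟨hb0, hle _ (hQr _ hb0 hsb).le⟩
  obtain ⟨ψ₀, ⟨h1, h2⟩, hmin⟩ := LowerSemicontinuousOn.exists_isMinOn ⟨_, hmem⟩
    (isCompact_diagForm_le (b := b) hν hfin C) (hlsc.lowerSemicontinuousOn _)
  have hs : Summable (diagTerm b ν ψ₀) := summable_diagTerm hν (ne_top_of_le_ne_top (by simp) h2)
  refine ⟨ψ₀, h1, hs, fun φ hφ hsφ => ?_⟩
  have h3 : Q ψ₀ ≤ Q φ := by
    by_cases h : Q φ ≤ ENNReal.ofReal C
    · exact hmin ⟨hφ, hle φ h⟩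
    · exact ((hmin hmem).trans (hQr _ hb0 hsb).le).trans (le_of_not_ge h)
  rw [hQr _ h1 hs, hQr _ hφ hsφ, ENNReal.ofReal_le_ofReal_iff (hnn _ hφ hsφ)] at h3
  linarith

theorem diagTerm_smul (c : ℂ) (ψ : H) (k : ι) :
    diagTerm b ν (c • ψ) k = ‖c‖ ^ 2 * diagTerm b ν ψ k := by
  rw [diagTerm, diagTerm, inner_smul_right, norm_mul]
  ring

theorem totalForm_smul (c : ℂ) (ψ : H) :
    totalForm b ν B (c • ψ) = ‖c‖ ^ 2 * totalForm b ν B ψ := by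
  have h : (inner ℂ (c • ψ) (B (c • ψ))) = ((‖c‖ ^ 2 : ℝ) : ℂ) * inner ℂ ψ (B ψ) := by
    rw [map_smul, inner_smul_left, inner_smul_right, ← mul_assoc,
      ← Complex.normSq_eq_conj_mul_self, Complex.normSq_eq_norm_sq]
  unfold totalForm
  rw [h, Complex.re_ofReal_mul, mul_add, ← tsum_mul_left]
  simp only [diagTerm_smul]

theorem le_totalForm_of_unit {E : ℝ}
    (h : ∀ φ : H, ‖φ‖ = 1 → Summable (diagTerm b ν φ) → E ≤ totalForm b ν B φ)
    {φ : H} (hs : Summable (diagTerm b ν φ)) : E * ‖φ‖ ^ 2 ≤ totalForm b ν B φ := by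
  by_cases hφ : φ = 0
  · subst hφ
    simp [totalForm, diagTerm]
  · have hn : ‖φ‖ ≠ 0 := norm_ne_zero_iff.2 hφ
    have h1 := h (((‖φ‖⁻¹ : ℝ) : ℂ) • φ)
      (by rw [norm_smul, Complex.norm_real, norm_inv, norm_norm, inv_mul_cancel₀ hn])
      ((hs.mul_left (‖((‖φ‖⁻¹ : ℝ) : ℂ)‖ ^ 2)).congr fun k => (diagTerm_smul _ _ _).symm)
    rw [totalForm_smul, Complex.norm_real, norm_inv, norm_norm, inv_pow,
      inv_mul_eq_div, le_div_iff₀ (by positivity)] at h1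
    exact h1

/-- Adding a multiple of a basis vector changes the form of `D + B` by a quadratic polynomial. -/
theorem totalForm_add_smul (hB : ∀ x y, inner ℂ (B x) y = inner ℂ x (B y)) {ψ : H}
    (hs : Summable (diagTerm b ν ψ)) (k : ι) (z : ℂ) :
    Summable (diagTerm b ν (ψ + z • b k)) ∧
    totalForm b ν B (ψ + z • b k) = totalForm b ν B ψ +
      2 * (conj z * (ν k * inner ℂ (b k) ψ + inner ℂ (b k) (B ψ))).re +
      ‖z‖ ^ 2 * (ν k + (inner ℂ (b k) (B (b k))).re) := by
  classical
  have hc : diagTerm b ν (ψ + z • b k) =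
      Function.update (diagTerm b ν ψ) k (ν k * ‖inner ℂ (b k) ψ + z‖ ^ 2) := by
    ext j
    rw [diagTerm, inner_add_right, inner_smul_right]
    by_cases h : j = k
    · subst h
      rw [inner_self_eq_norm_sq_to_K, b.orthonormal.1]
      simp
    · rw [b.orthonormal.2 h]
      simp [h, diagTerm]
  have h1 := hs.hasSum.update k (ν k * ‖inner ℂ (b k) ψ + z‖ ^ 2)
  rw [← hc] at h1
  refine ⟨h1.summable, ?_⟩
  have h2 : inner ℂ ψ (B (b k)) = conj (inner ℂ (b k) (B ψ)) := by
    rw [inner_conj_symm, hB]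
  have h3 : ‖inner ℂ (b k) ψ + z‖ ^ 2 =
      ‖inner ℂ (b k) ψ‖ ^ 2 + 2 * (conj z * inner ℂ (b k) ψ).re + ‖z‖ ^ 2 := by
    simp only [← Complex.normSq_eq_norm_sq, Complex.normSq_apply, Complex.add_re, Complex.add_im,
      Complex.mul_re, Complex.conj_re, Complex.conj_im]
    ring
  unfold totalForm
  rw [h1.tsum_eq, h3, map_add, map_smul, inner_add_left, inner_add_right, inner_add_right,
    inner_smul_left, inner_smul_right, inner_smul_left, inner_smul_right, h2, diagTerm]
  have h4 : ‖z‖ ^ 2 = z.re * z.re + z.im * z.im := by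
    rw [← Complex.normSq_eq_norm_sq, Complex.normSq_apply]
  rw [h4]
  simp only [Complex.add_re, Complex.mul_re, Complex.conj_re, Complex.conj_im, Complex.mul_im,
    Complex.add_im, Complex.ofReal_re, Complex.ofReal_im]
  ring

/-- The quadratic form computes `⟪ψ, (D + B) ψ⟫` on the domain of `D + B`. -/
theorem IsDiagImage.totalForm_eq {ψ χ : H} (h : IsDiagImage b ν B ψ χ) :
    Summable (diagTerm b ν ψ) ∧ totalForm b ν B ψ = (inner ℂ ψ χ).re := by
  have h1 := Complex.hasSum_re (b.hasSum_inner_mul_inner ψ (χ - B ψ))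
  have h2 : HasSum (diagTerm b ν ψ) (inner ℂ ψ (χ - B ψ)).re := by
    convert! h1 using 1
    ext k
    rw [inner_sub_right, ← h k, add_sub_cancel_right, ← inner_conj_symm, mul_left_comm,
      ← Complex.normSq_eq_conj_mul_self, Complex.normSq_eq_norm_sq, ← Complex.ofReal_mul,
      Complex.ofReal_re, diagTerm]
  refine ⟨h2.summable, ?_⟩
  rw [totalForm, h2.tsum_eq, inner_sub_right, Complex.sub_re]
  ring

/-- The lowest eigenvalue of `D + B` exists and bounds the quadratic form from below. -/
theorem exists_ground_state [CompleteSpace H] [Nonempty ι] (b : HilbertBasis ι ℂ H) (hν : ∀ k, 0 ≤ ν k)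
    (hfin : ∀ c : ℝ, {k | ν k ≤ c}.Finite) (hB : ∀ x y, inner ℂ (B x) y = inner ℂ x (B y)) :
    ∃ (E : ℝ) (ψ₀ : H), ψ₀ ≠ 0 ∧ IsDiagImage b ν B ψ₀ ((E : ℂ) • ψ₀) ∧
      ∀ ψ χ, IsDiagImage b ν B ψ χ → E * ‖ψ‖ ^ 2 ≤ (inner ℂ ψ χ).re := by
  obtain ⟨ψ₀, h1, hs, hmin⟩ := exists_unit_minimizer b hν hfin B
  set E := totalForm b ν B ψ₀ with hE
  have hbd : ∀ φ : H, Summable (diagTerm b ν φ) → E * ‖φ‖ ^ 2 ≤ totalForm b ν B φ :=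
    fun φ hsφ => le_totalForm_of_unit hmin hsφ
  refine ⟨E, ψ₀, fun h => by simp [h] at h1, fun k => ?_, fun ψ χ h => ?_⟩
  · rw [inner_smul_right, ← sub_eq_zero]
    set w : ℂ := ν k * inner ℂ (b k) ψ₀ + inner ℂ (b k) (B ψ₀) - E * inner ℂ (b k) ψ₀ with hw
    set m : ℝ := ν k + (inner ℂ (b k) (B (b k))).re - E with hm
    -- The first variation in the direction `z • b k` is `2 re (conj z * w)`.
    have hvar : ∀ z : ℂ, 0 ≤ 2 * (conj z * w).re + ‖z‖ ^ 2 * m := by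
      intro z
      obtain ⟨g1, g2⟩ := totalForm_add_smul hB hs k z
      have g3 := hbd _ g1
      have g4 : ‖ψ₀ + z • b k‖ ^ 2 = 1 + 2 * (conj z * inner ℂ (b k) ψ₀).re + ‖z‖ ^ 2 := by
        rw [norm_add_sq (𝕜 := ℂ), h1, norm_smul, b.orthonormal.1, inner_smul_right,
          show inner ℂ ψ₀ (b k) = conj (inner ℂ (b k) ψ₀) from (inner_conj_symm _ _).symm]
        simp [Complex.mul_re, -inner_conj_symm]
      rw [g2, g4, ← hE] at g3
      have g5 : (conj z * w).re = (conj z * (ν k * inner ℂ (b k) ψ₀ + inner ℂ (b k) (B ψ₀))).re -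
          E * (conj z * inner ℂ (b k) ψ₀).re := by
        rw [hw, mul_sub, Complex.sub_re, mul_left_comm, Complex.re_ofReal_mul]
      rw [g5, hm]
      linarith
    by_contra hne
    have hw0 : 0 < ‖w‖ ^ 2 := by positivity
    have ht : 0 < (|m| + 1)⁻¹ := by positivity
    have g := hvar (-((((|m| + 1)⁻¹ : ℝ) : ℂ) * w))
    rw [map_neg, map_mul, Complex.conj_ofReal, neg_mul, mul_assoc,
      ← Complex.normSq_eq_conj_mul_self, Complex.normSq_eq_norm_sq, norm_neg, norm_mul,
      Complex.norm_real, Real.norm_of_nonneg ht.le, ← Complex.ofReal_mul, Complex.neg_re,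
      Complex.ofReal_re] at g
    have g6 : (|m| + 1)⁻¹ * m ≤ 1 := by
      rw [inv_mul_le_iff₀ (by positivity)]
      linarith [le_abs_self m]
    have g7 : 0 < (|m| + 1)⁻¹ * ‖w‖ ^ 2 := by positivity
    nlinarith
  · obtain ⟨h2, h3⟩ := h.totalForm_eq
    rw [← h3]
    exact hbd ψ h2

/-- Second-order lower bound. If the diagonal part has a gap `g` above the vector `b k₀`, the
perturbation `J W ≥ 0` shifts the energy of a unit vector by at least its mean in `b k₀`, up to
an error of second order in `‖W (b k₀)‖`. -/
theorem gap_lower_bound (hν : ∀ k, 0 ≤ ν k) {k₀ : ι} {g : ℝ} (hg : 0 < g)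
    (hgap : ∀ k, k ≠ k₀ → g ≤ ν k) {W : H →L[ℂ] H}
    (hW : ∀ x y, inner ℂ (W x) y = inner ℂ x (W y)) (hW0 : ∀ x, 0 ≤ (inner ℂ x (W x)).re)
    {J : ℝ} (hJ : 0 ≤ J) (hsmall : 2 * J * (inner ℂ (b k₀) (W (b k₀))).re ≤ g)
    {ψ : H} (hψ : ‖ψ‖ = 1) (hs : Summable (diagTerm b ν ψ)) :
    J * (inner ℂ (b k₀) (W (b k₀))).re - 2 * J ^ 2 * ‖W (b k₀)‖ ^ 2 / g ≤
      ∑' k, diagTerm b ν ψ k + J * (inner ℂ ψ (W ψ)).re := by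
  classical
  set e := b k₀
  have he : ‖e‖ = 1 := b.orthonormal.1 k₀
  set α : ℂ := inner ℂ e ψ with hα
  set φ : H := ψ - α • e with hφ
  have hψe : ψ = α • e + φ := by rw [hφ]; abel
  have horth : inner ℂ (α • e) φ = 0 := by
    rw [hφ, inner_smul_left, inner_sub_right, inner_smul_right, inner_self_eq_norm_sq_to_K, he,
      ← hα]
    simp
  have hnorm : ‖α‖ ^ 2 + ‖φ‖ ^ 2 = 1 := by
    have := norm_add_sq_eq_norm_sq_add_norm_sq_of_inner_eq_zero _ _ horth
    rw [← hψe, hψ, norm_smul, he] at this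
    nlinarith
  have h1 : g * ‖φ‖ ^ 2 ≤ ∑' k, diagTerm b ν ψ k := by
    have e1 := (hasSum_norm_sq b ψ).update k₀ 0
    rw [hψ] at e1
    have e2 : g * ‖φ‖ ^ 2 = g * (0 - ‖inner ℂ (b k₀) ψ‖ ^ 2 + 1 ^ 2) := by
      change _ = g * (0 - ‖α‖ ^ 2 + 1 ^ 2)
      rw [one_pow, ← hnorm]
      ring
    rw [e2]
    refine hasSum_le (fun k => ?_) (e1.mul_left g) hs.hasSum
    by_cases h : k = k₀
    · subst h
      simpa using diagTerm_nonneg hν ψ k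
    · rw [Function.update_of_ne h, diagTerm]
      exact mul_le_mul_of_nonneg_right (hgap k h) (sq_nonneg _)
  have h2 : (inner ℂ ψ (W ψ)).re = ‖α‖ ^ 2 * (inner ℂ e (W e)).re +
      2 * (conj α * inner ℂ (W e) φ).re + (inner ℂ φ (W φ)).re := by
    have e1 : inner ℂ φ (W e) = conj (inner ℂ (W e) φ) := (inner_conj_symm _ _).symm
    have e2 : ‖α‖ ^ 2 = α.re * α.re + α.im * α.im := by
      rw [← Complex.normSq_eq_norm_sq, Complex.normSq_apply]
    conv_lhs => rw [hψe]
    rw [map_add, map_smul, inner_add_left, inner_add_right, inner_add_right, inner_smul_left,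
      inner_smul_right, inner_smul_left, inner_smul_right, e1, ← hW e φ, e2]
    simp only [Complex.add_re, Complex.mul_re, Complex.conj_re, Complex.conj_im, Complex.mul_im]
    ring
  have h3 : -(‖W e‖ * ‖φ‖) ≤ (conj α * inner ℂ (W e) φ).re := by
    have e1 := Complex.abs_re_le_norm (conj α * inner ℂ (W e) φ)
    rw [norm_mul, RCLike.norm_conj] at e1
    have e2 := norm_inner_le_norm (𝕜 := ℂ) (W e) φ
    have e3 : ‖α‖ ≤ 1 := by nlinarith [norm_nonneg α, sq_nonneg ‖φ‖]
    have e4 : ‖α‖ * ‖inner ℂ (W e) φ‖ ≤ 1 * (‖W e‖ * ‖φ‖) := by gcongr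
    linarith [neg_abs_le (conj α * inner ℂ (W e) φ).re]
  have h4 := hW0 φ
  set w := (inner ℂ e (W e)).re
  set d := ‖W e‖
  set p := ‖φ‖
  have h5 : -(2 * J ^ 2 * d ^ 2 / g) ≤ g / 2 * p ^ 2 - 2 * J * d * p := by
    have : g / 2 * p ^ 2 - 2 * J * d * p + 2 * J ^ 2 * d ^ 2 / g =
        (g * p - 2 * J * d) ^ 2 / (2 * g) := by
      field_simp
      ring
    have h0 : 0 ≤ (g * p - 2 * J * d) ^ 2 / (2 * g) := by positivity
    linarith
  have h6 : J * (inner ℂ ψ (W ψ)).re ≥ J * ((1 - p ^ 2) * w - 2 * (d * p)) := by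
    rw [h2, show (1 : ℝ) - p ^ 2 = ‖α‖ ^ 2 by linarith]
    refine mul_le_mul_of_nonneg_left ?_ hJ
    linarith
  nlinarith [mul_nonneg (sub_nonneg.2 hsmall) (sq_nonneg p)]

end Abstract

/-! ### The Hamiltonian in the number basis -/

theorem norm_incl_le {φ η : Core M} (h : ∀ x, ‖φ x‖ ≤ ‖η x‖) : ‖incl φ‖ ≤ ‖incl η‖ := by
  refine Lp.norm_le_norm_of_ae_le ?_
  filter_upwards [φ.coeFn_toLp 2 volume, η.coeFn_toLp 2 volume] with x h1 h2
  rw [incl, incl, h1, h2]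
  exact h x

theorem norm_incl_cosPhase_le (lam : Fin M → ℝ) (φ : Core M) :
    ‖incl (cosPhase lam φ)‖ ≤ 1 * ‖incl φ‖ := by
  rw [one_mul]
  refine norm_incl_le fun x => ?_
  rw [cosPhase_apply, norm_mul, Complex.norm_real]
  exact mul_le_of_le_one_left (norm_nonneg _) (Real.abs_cos_le_one _)

/-- The bounded operator `cos θ` on `L²`, as the extension of `cosPhase` by density. -/
def cosOp (lam : Fin M → ℝ) : Hilb M →L[ℂ] Hilb M :=
  ((inclL M).toLinearMap ∘ₗ (cosPhase lam).toLinearMap).extendOfNorm (inclL M).toLinearMap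

theorem cosOp_incl (lam : Fin M → ℝ) (φ : Core M) :
    cosOp lam (incl φ) = incl (cosPhase lam φ) :=
  LinearMap.extendOfNorm_eq (e := (inclL M).toLinearMap) denseRange_incl
    ⟨1, norm_incl_cosPhase_le lam⟩ φ

theorem norm_cosOp_le (lam : Fin M → ℝ) (ψ : Hilb M) : ‖cosOp lam ψ‖ ≤ ‖ψ‖ := by
  have h := LinearMap.norm_extendOfNorm_apply_le (e := (inclL M).toLinearMap)
    (f := (inclL M).toLinearMap ∘ₗ (cosPhase lam).toLinearMap) denseRange_incl 1
    (norm_incl_cosPhase_le lam) ψ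
  rwa [one_mul] at h

theorem inner_cosPhase (lam : Fin M → ℝ) (φ η : Core M) :
    inner ℂ (incl (cosPhase lam φ)) (incl η) = inner ℂ (incl φ) (incl (cosPhase lam η)) := by
  rw [inner_incl, inner_incl]
  congr 1
  ext x
  rw [cosPhase_apply, cosPhase_apply, map_mul, Complex.conj_ofReal]
  ring

theorem inner_cosOp (lam : Fin M → ℝ) (ψ χ : Hilb M) :
    inner ℂ (cosOp lam ψ) χ = inner ℂ ψ (cosOp lam χ) := by
  induction ψ, χ using denseRange_incl.induction_on₂ with
  | hp => exact isClosed_eq (by fun_prop) (by fun_prop)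
  | h φ η => rw [cosOp_incl, cosOp_incl, inner_cosPhase]

/-- The eigenvalues `∑ n, ħ ω n k n` of the free Hamiltonian. -/
def freeLevel (hbar : ℝ) (ω : Fin M → ℝ) (k : Fin M → ℕ) : ℝ := ∑ n, hbar * ω n * k n

theorem freeLevel_nonneg {hbar : ℝ} {ω : Fin M → ℝ} (hh : 0 < hbar) (hω : ∀ n, 0 < ω n)
    (k : Fin M → ℕ) : 0 ≤ freeLevel hbar ω k :=
  Finset.sum_nonneg fun n _ => mul_nonneg (mul_pos hh (hω n)).le (Nat.cast_nonneg _)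

theorem mul_le_freeLevel {hbar : ℝ} {ω : Fin M → ℝ} (hh : 0 < hbar) (hω : ∀ n, 0 < ω n)
    (k : Fin M → ℕ) (n : Fin M) : hbar * ω n * k n ≤ freeLevel hbar ω k :=
  Finset.single_le_sum (f := fun n => hbar * ω n * k n)
    (fun n _ => mul_nonneg (mul_pos hh (hω n)).le (Nat.cast_nonneg _)) (Finset.mem_univ n)

theorem finite_freeLevel_le {hbar : ℝ} {ω : Fin M → ℝ} (hh : 0 < hbar) (hω : ∀ n, 0 < ω n)
    (c : ℝ) : {k : Fin M → ℕ | freeLevel hbar ω k ≤ c}.Finite := by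
  refine (Set.finite_Iic (fun n => ⌈c / (hbar * ω n)⌉₊)).subset fun k hk n => ?_
  have h := (mul_le_freeLevel hh hω k n).trans hk
  have h1 : (k n : ℝ) ≤ c / (hbar * ω n) := by
    rw [le_div_iff₀ (mul_pos hh (hω n))]
    linarith
  exact_mod_cast h1.trans (Nat.le_ceil _)

/-- The free Hamiltonian `∑ n, ħ ω n a† n a n`. -/
def freeCore (hbar : ℝ) (ω : Fin M → ℝ) : Core M →L[ℂ] Core M :=
  ∑ n, ((hbar * ω n : ℝ) : ℂ) • (creat n ∘L annih n)

theorem freeCore_apply (hbar : ℝ) (ω : Fin M → ℝ) (φ : Core M) :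
    freeCore hbar ω φ = ∑ n, ((hbar * ω n : ℝ) : ℂ) • creat n (annih n φ) := by
  rw [freeCore, sum_apply]
  rfl

theorem hamCore_apply (hbar EJ : ℝ) (ω lam : Fin M → ℝ) (φ : Core M) :
    hamCore hbar EJ ω lam φ = freeCore hbar ω φ - (EJ : ℂ) • cosPhase lam φ := rfl

theorem inner_freeCore (hbar : ℝ) (ω : Fin M → ℝ) (φ η : Core M) :
    inner ℂ (incl (freeCore hbar ω φ)) (incl η) = inner ℂ (incl φ) (incl (freeCore hbar ω η)) := by
  rw [freeCore_apply, freeCore_apply, incl_sum, incl_sum, sum_inner, inner_sum]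
  refine Finset.sum_congr rfl fun n _ => ?_
  rw [incl_smul, incl_smul, inner_smul_left, inner_smul_right, Complex.conj_ofReal, inner_number]

theorem freeCore_numState (hbar : ℝ) (ω : Fin M → ℝ) (k : Fin M → ℕ) :
    freeCore hbar ω (numState k) = (freeLevel hbar ω k : ℂ) • numState k := by
  rw [freeCore_apply, freeLevel, Complex.ofReal_sum, Finset.sum_smul]
  refine Finset.sum_congr rfl fun n _ => ?_
  rw [number_numState, smul_smul]
  push_cast
  rfl

/-- `hamCore` is symmetric, so it is contained in the self-adjoint Hamiltonian. -/
theorem isHamImage_incl (hbar EJ : ℝ) (ω lam : Fin M → ℝ) (φ : Core M) :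
    IsHamImage hbar EJ ω lam (incl φ) (incl (hamCore hbar EJ ω lam φ)) := by
  intro η
  rw [hamCore_apply, hamCore_apply, incl_sub, incl_sub, inner_sub_left, inner_sub_right,
    inner_freeCore, incl_smul, incl_smul, inner_smul_left, inner_smul_right, inner_cosPhase,
    Complex.conj_ofReal]

/-- The self-adjoint Hamiltonian is the sum of the maximal diagonal operator of the free levels in
the number basis and the bounded operator `-EJ cos θ`. -/
theorem isHamImage_iff (hbar EJ : ℝ) (ω lam : Fin M → ℝ) (ψ χ : Hilb M) :
    IsHamImage hbar EJ ω lam ψ χ ↔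
      IsDiagImage (numBasis M) (freeLevel hbar ω) (-((EJ : ℂ) • cosOp lam)) ψ χ := by
  have hcos : ∀ φ : Core M, inner ℂ (incl ((EJ : ℂ) • cosPhase lam φ)) ψ =
      inner ℂ (incl φ) (((EJ : ℂ) • cosOp lam) ψ) := by
    intro φ
    rw [incl_smul, inner_smul_left, Complex.conj_ofReal, ← cosOp_incl, inner_cosOp, smul_apply,
      inner_smul_right]
  constructor
  · intro h k
    have h1 := h (((‖incl (numState k)‖⁻¹ : ℝ) : ℂ) • numState k)
    rw [hamCore_apply, incl_sub, inner_sub_left, hcos, map_smul, freeCore_numState, smul_comm,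
      incl_smul (freeLevel hbar ω k : ℂ), inner_smul_left, Complex.conj_ofReal,
      ← numBasis_apply] at h1
    rw [neg_apply, inner_neg_right, ← sub_eq_add_neg, h1]
  · intro h φ
    have h1 := (numBasis M).hasSum_inner_mul_inner (incl (freeCore hbar ω φ)) ψ
    have h2 := (numBasis M).hasSum_inner_mul_inner (incl φ)
      (χ - (-((EJ : ℂ) • cosOp lam)) ψ)
    have h3 : (fun k => inner ℂ (incl (freeCore hbar ω φ)) (numBasis M k) *
        inner ℂ (numBasis M k) ψ) = fun k => inner ℂ (incl φ) (numBasis M k) *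
        inner ℂ (numBasis M k) (χ - (-((EJ : ℂ) • cosOp lam)) ψ) := by
      ext k
      rw [inner_sub_right (numBasis M k), ← h k, add_sub_cancel_right]
      have h4 : inner ℂ (incl (freeCore hbar ω φ)) (numBasis M k) =
          (freeLevel hbar ω k : ℂ) * inner ℂ (incl φ) (numBasis M k) := by
        rw [numBasis_apply, inner_freeCore, map_smul, freeCore_numState, smul_comm,
          incl_smul (freeLevel hbar ω k : ℂ), inner_smul_right]
      rw [h4]
      ring
    rw [h3] at h1
    rw [hamCore_apply, incl_sub, inner_sub_left, h1.unique h2, hcos, inner_sub_right, neg_apply,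
      inner_neg_right]
    ring

theorem inner_neg_smul_cosOp (EJ : ℝ) (lam : Fin M → ℝ) (ψ χ : Hilb M) :
    inner ℂ ((-((EJ : ℂ) • cosOp lam)) ψ) χ = inner ℂ ψ ((-((EJ : ℂ) • cosOp lam)) χ) := by
  rw [neg_apply, neg_apply, inner_neg_left, inner_neg_right, smul_apply, smul_apply,
    inner_smul_left, inner_smul_right, Complex.conj_ofReal, inner_cosOp]

/-- The ground state energy is the least eigenvalue, and it bounds the mean energy of every vector in
the domain of the Hamiltonian from below. -/
theorem groundEnergy_spec (hbar EJ : ℝ) (ω lam : Fin M → ℝ) (hh : 0 < hbar) (hω : ∀ n, 0 < ω n) :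
    IsLeast {E : ℝ | IsEnergyLevel hbar EJ ω lam E} (groundEnergy hbar EJ ω lam) ∧
      ∀ ψ χ, IsHamImage hbar EJ ω lam ψ χ →
        groundEnergy hbar EJ ω lam * ‖ψ‖ ^ 2 ≤ (inner ℂ ψ χ).re := by
  obtain ⟨E, ψ₀, h0, hE, hbd⟩ := exists_ground_state (numBasis M) (freeLevel_nonneg hh hω)
    (finite_freeLevel_le hh hω) (inner_neg_smul_cosOp EJ lam)
  have hleast : IsLeast {E : ℝ | IsEnergyLevel hbar EJ ω lam E} E := by
    refine ⟨⟨ψ₀, h0, (isHamImage_iff _ _ _ _ _ _).2 hE⟩, ?_⟩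
    rintro E' ⟨ψ, hψ, hE'⟩
    have h1 := hbd ψ _ ((isHamImage_iff _ _ _ _ _ _).1 hE')
    rw [inner_smul_right, Complex.re_ofReal_mul, ← ofReal_norm_sq, ← Complex.ofReal_pow,
      Complex.ofReal_re] at h1
    exact le_of_mul_le_mul_right h1 (by positivity)
  have hg : groundEnergy hbar EJ ω lam = E := hleast.csInf_eq
  rw [hg]
  exact ⟨hleast, fun ψ χ h => hbd ψ χ ((isHamImage_iff _ _ _ _ _ _).1 h)⟩

/-! ### Dilations and the squeezing groups -/

/-- The diagonal scaling `x ↦ (exp (s n) * x n)ₙ` of configuration space. -/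
def scaling (s : Fin M → ℝ) : Conf M ≃L[ℝ] Conf M :=
  LinearEquiv.toContinuousLinearEquiv
    { toFun := fun x => WithLp.toLp 2 fun n => Real.exp (s n) * x n
      invFun := fun x => WithLp.toLp 2 fun n => Real.exp (-s n) * x n
      map_add' := fun x y => by ext n; simp [mul_add]
      map_smul' := fun c x => by ext n; simp; ring
      left_inv := fun x => by ext n; simp [← mul_assoc, ← Real.exp_add]
      right_inv := fun x => by ext n; simp [← mul_assoc, ← Real.exp_add] }

@[simp]
theorem scaling_apply (s : Fin M → ℝ) (x : Conf M) (n : Fin M) :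
    scaling s x n = Real.exp (s n) * x n := rfl

theorem scaling_add (s t : Fin M → ℝ) (x : Conf M) :
    scaling (s + t) x = scaling t (scaling s x) := by
  ext n
  simp [Real.exp_add]
  ring

theorem det_scaling (s : Fin M → ℝ) :
    LinearMap.det ((scaling s : Conf M →L[ℝ] Conf M) : Conf M →ₗ[ℝ] Conf M) =
      Real.exp (∑ n, s n) := by
  rw [← LinearMap.det_toMatrix (EuclideanSpace.basisFun (Fin M) ℝ).toBasis]
  have h : LinearMap.toMatrix (EuclideanSpace.basisFun (Fin M) ℝ).toBasis
      (EuclideanSpace.basisFun (Fin M) ℝ).toBasis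
      ((scaling s : Conf M →L[ℝ] Conf M) : Conf M →ₗ[ℝ] Conf M) =
      Matrix.diagonal fun n => Real.exp (s n) := by
    ext i j
    rw [LinearMap.toMatrix_apply]
    by_cases h : i = j
    · subst h; simp
    · simp [h]
  rw [h, Matrix.det_diagonal, Real.exp_sum]

theorem integral_comp_scaling {F : Type*} [NormedAddCommGroup F] [NormedSpace ℝ F]
    (s : Fin M → ℝ) (f : Conf M → F) :
    ∫ x, f (scaling s x) = Real.exp (-∑ n, s n) • ∫ x, f x := by
  have h := Measure.map_linearMap_addHaar_eq_smul_addHaar (volume : Measure (Conf M))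
    (f := ((scaling s : Conf M →L[ℝ] Conf M) : Conf M →ₗ[ℝ] Conf M))
    (by rw [det_scaling]; positivity)
  rw [det_scaling, abs_of_pos (by positivity), ← Real.exp_neg] at h
  have h1 := (scaling s).toHomeomorph.measurableEmbedding.integral_map
    (μ := (volume : Measure (Conf M))) f
  change ∫ y, f y ∂(Measure.map (scaling s) volume) = ∫ x, f (scaling s x) at h1
  have h2 : Measure.map (scaling s) (volume : Measure (Conf M)) =
    ENNReal.ofReal (Real.exp (-∑ n, s n)) • volume := h
  rw [← h1, h2, integral_smul_measure, ENNReal.toReal_ofReal (Real.exp_pos _).le]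

/-- The unitary dilation `φ ↦ exp (∑ n, s n / 2) φ (exp (s n) x n)ₙ` on Schwartz functions. -/
def dilate (s : Fin M → ℝ) : Core M →L[ℂ] Core M :=
  ((Real.exp ((∑ n, s n) / 2) : ℝ) : ℂ) •
    SchwartzMap.compCLMOfContinuousLinearEquiv ℂ (scaling s)

theorem dilate_apply (s : Fin M → ℝ) (φ : Core M) (x : Conf M) :
    dilate s φ x = (Real.exp ((∑ n, s n) / 2) : ℂ) * φ (scaling s x) := rfl

theorem dilate_add (s t : Fin M → ℝ) (φ : Core M) :
    dilate (s + t) φ = dilate s (dilate t φ) := by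
  ext x
  simp only [dilate_apply, scaling_add, Pi.add_apply, Finset.sum_add_distrib, add_div,
    Real.exp_add]
  push_cast
  ring

theorem dilate_zero (φ : Core M) : dilate 0 φ = φ := by
  ext x
  have h : scaling (0 : Fin M → ℝ) x = x := by ext n; simp
  simp [dilate_apply, h]

theorem inner_dilate (s : Fin M → ℝ) (φ η : Core M) :
    inner ℂ (incl (dilate s φ)) (incl (dilate s η)) = inner ℂ (incl φ) (incl η) := by
  rw [inner_incl, inner_incl]
  have h : ∀ x, conj (dilate s φ x) * dilate s η x =
      Real.exp (∑ n, s n) • (fun y => conj (φ y) * η y) (scaling s x) := by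
    intro x
    have e : (Real.exp (∑ n, s n) : ℂ) =
        (Real.exp ((∑ n, s n) / 2) : ℂ) * (Real.exp ((∑ n, s n) / 2) : ℂ) := by
      rw [← Complex.ofReal_mul, ← Real.exp_add, add_halves]
    rw [dilate_apply, dilate_apply, map_mul, Complex.conj_ofReal, Complex.real_smul, e]
    ring
  simp_rw [h]
  rw [integral_smul, integral_comp_scaling s (fun y => conj (φ y) * η y), smul_smul,
    ← Real.exp_add, add_neg_cancel, Real.exp_zero, one_smul]

theorem norm_incl_dilate (s : Fin M → ℝ) (φ : Core M) : ‖incl (dilate s φ)‖ = ‖incl φ‖ := by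
  have h := inner_dilate s φ φ
  rw [← ofReal_norm_sq, ← ofReal_norm_sq] at h
  have h1 : ‖incl (dilate s φ)‖ ^ 2 = ‖incl φ‖ ^ 2 := by exact_mod_cast h
  exact (pow_left_inj₀ (norm_nonneg _) (norm_nonneg _) two_ne_zero).1 h1

/-- The dilation as an isometric operator on `L²`. -/
def dilateOp (s : Fin M → ℝ) : Hilb M →L[ℂ] Hilb M :=
  ((inclL M).toLinearMap ∘ₗ (dilate s).toLinearMap).extendOfNorm (inclL M).toLinearMap

theorem dilateOp_incl (s : Fin M → ℝ) (φ : Core M) :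
    dilateOp s (incl φ) = incl (dilate s φ) :=
  LinearMap.extendOfNorm_eq (e := (inclL M).toLinearMap) denseRange_incl
    ⟨1, fun φ => by rw [one_mul]; exact (norm_incl_dilate s φ).le⟩ φ

theorem norm_dilateOp (s : Fin M → ℝ) (ψ : Hilb M) : ‖dilateOp s ψ‖ = ‖ψ‖ := by
  induction ψ using denseRange_incl.induction_on with
  | hp => exact isClosed_eq (by fun_prop) (by fun_prop)
  | ih φ => rw [dilateOp_incl, norm_incl_dilate]

theorem dilateOp_add (s t : Fin M → ℝ) : dilateOp (s + t) = dilateOp s * dilateOp t := by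
  ext1 ψ
  induction ψ using denseRange_incl.induction_on with
  | hp => exact isClosed_eq (by fun_prop) (by fun_prop)
  | ih φ =>
    change dilateOp (s + t) (incl φ) = dilateOp s (dilateOp t (incl φ))
    rw [dilateOp_incl, dilateOp_incl, dilateOp_incl, dilate_add]

theorem dilateOp_zero : dilateOp (0 : Fin M → ℝ) = 1 := by
  ext1 ψ
  induction ψ using denseRange_incl.induction_on with
  | hp => exact isClosed_eq (by fun_prop) (by fun_prop)
  | ih φ => rw [dilateOp_incl, dilate_zero]; rfl

/-- The squeezing generator is the generator `x n ∂ n + 1 / 2` of dilations in the `n`-th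
coordinate. -/
theorem squeezeGen_eq (n : Fin M) (φ : Core M) :
    squeezeGen n φ = (2 : ℂ) • halfPos n (partialD n φ) + (1 / 2 : ℂ) • φ := by
  have h : squeezeGen n φ = (1 / 2 : ℂ) • (annih n (annih n φ) - creat n (creat n φ)) := rfl
  rw [h]
  simp only [annih_eq, creat_eq, map_add, map_sub, partialD_halfPos, if_true]
  module

theorem squeezeGen_apply (n : Fin M) (φ : Core M) (x : Conf M) :
    squeezeGen n φ x = (x n : ℂ) * partialD n φ x + φ x / 2 := by
  rw [squeezeGen_eq, add_apply, smul_apply, smul_apply, halfPos_apply, smul_eq_mul, smul_eq_mul]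
  push_cast
  ring

theorem scaling_single (n : Fin M) (t : ℝ) (x : Conf M) :
    scaling (Pi.single n t) x = x + ((Real.exp t - 1) * x n) • EuclideanSpace.single n (1 : ℝ) := by
  ext m
  by_cases h : m = n
  · subst h
    simp
    ring
  · simp [h]

theorem hasDerivAt_dilate_apply (n : Fin M) (φ : Core M) (x : Conf M) (t : ℝ) :
    HasDerivAt (fun t => dilate (Pi.single n t) φ x)
      (dilate (Pi.single n t) (squeezeGen n φ) x) t := by
  have h1 : HasDerivAt (fun t => scaling (Pi.single n t) x)
      ((Real.exp t * x n) • EuclideanSpace.single n (1 : ℝ)) t := by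
    simp_rw [scaling_single]
    exact ((((Real.hasDerivAt_exp t).sub_const 1).mul_const (x n)).smul_const _).const_add x
  have h2 : HasDerivAt (fun t => φ (scaling (Pi.single n t) x))
      (((Real.exp t * x n : ℝ) : ℂ) * partialD n φ (scaling (Pi.single n t) x)) t := by
    have := (φ.hasFDerivAt (scaling (Pi.single n t) x)).comp_hasDerivAt t h1
    rw [partialD_apply, ← Complex.real_smul, ← map_smul]
    exact this
  have h3 : HasDerivAt (fun t : ℝ => ((Real.exp (t / 2) : ℝ) : ℂ))
      ((Real.exp (t / 2) * (1 / 2) : ℝ) : ℂ) t :=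
    (((hasDerivAt_id t).div_const 2).exp).ofReal_comp
  have h4 := h3.mul h2
  convert! h4 using 1
  · ext t
    simp [dilate_apply]
  · rw [dilate_apply, squeezeGen_apply]
    simp
    ring

/-- Differentiation under the `L²` norm, by dominated convergence. -/
theorem hasDerivAt_incl_of_dominated {F F' : ℝ → Core M} {g : Conf M → ℝ}
    (hF : ∀ t x, HasDerivAt (fun t => F t x) (F' t x) t)
    (hg : Integrable (fun x => g x ^ 2)) (hb : ∀ t ∈ Metric.ball (0 : ℝ) 1, ∀ x, ‖F' t x‖ ≤ g x) :
    HasDerivAt (fun t => incl (F t)) (incl (F' 0)) 0 := by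
  rw [hasDerivAt_iff_tendsto_slope_zero, tendsto_iff_norm_sub_tendsto_zero]
  have hmem : Metric.ball (0 : ℝ) 1 ∈ 𝓝[≠] (0 : ℝ) :=
    mem_nhdsWithin_of_mem_nhds (Metric.ball_mem_nhds _ one_pos)
  have h1 : ∀ t : ℝ, ‖t⁻¹ • (incl (F (0 + t)) - incl (F 0)) - incl (F' 0)‖ ^ 2 =
      ∫ x, ‖t⁻¹ • (F t x - F 0 x) - F' 0 x‖ ^ 2 := by
    intro t
    have e : t⁻¹ • (incl (F (0 + t)) - incl (F 0)) - incl (F' 0) =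
        incl (((t⁻¹ : ℝ) : ℂ) • (F t - F 0) - F' 0) := by
      rw [zero_add, incl_sub, incl_smul, incl_sub]
      rfl
    rw [e, norm_sq_incl]
    rfl
  have h2 : Tendsto (fun t : ℝ => ∫ x, ‖t⁻¹ • (F t x - F 0 x) - F' 0 x‖ ^ 2) (𝓝[≠] 0)
      (𝓝 (∫ _ : Conf M, (0 : ℝ))) := by
    refine tendsto_integral_filter_of_dominated_convergence (fun x => 4 * g x ^ 2) ?_ ?_
      (hg.const_mul 4) ?_
    · refine Eventually.of_forall fun t => Continuous.aestronglyMeasurable ?_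
      have := (F t).continuous
      have := (F 0).continuous
      have := (F' 0).continuous
      fun_prop
    · filter_upwards [hmem, self_mem_nhdsWithin] with t ht ht0
      refine Eventually.of_forall fun x => ?_
      have e1 : ‖F t x - F 0 x‖ ≤ g x * ‖t - 0‖ :=
        Convex.norm_image_sub_le_of_norm_hasDerivWithin_le (𝕜 := ℝ) (s := Metric.ball (0 : ℝ) 1)
          (f := fun t => F t x) (f' := fun t => F' t x) (fun t _ => (hF t x).hasDerivWithinAt)
          (fun t ht => hb t ht x) (convex_ball _ _) (Metric.mem_ball_self one_pos) ht
      have e2 : ‖t⁻¹ • (F t x - F 0 x)‖ ≤ g x := by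
        rw [norm_smul, norm_inv, inv_mul_le_iff₀ (norm_pos_iff.2 ht0), mul_comm]
        simpa using e1
      have e3 := hb 0 (Metric.mem_ball_self one_pos) x
      have e4 := (norm_sub_le (t⁻¹ • (F t x - F 0 x)) (F' 0 x)).trans (add_le_add e2 e3)
      rw [norm_pow, norm_norm]
      calc _ ≤ (g x + g x) ^ 2 := by gcongr
        _ = _ := by ring
    · refine Eventually.of_forall fun x => ?_
      have e := (hF 0 x).tendsto_slope_zero
      rw [tendsto_iff_norm_sub_tendsto_zero] at e
      have e2 := e.pow 2
      simpa using e2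
  have h3 : Tendsto (fun t : ℝ => ‖t⁻¹ • (incl (F (0 + t)) - incl (F 0)) - incl (F' 0)‖ ^ 2)
      (𝓝[≠] 0) (𝓝 0) := by
    simp_rw [h1]
    simpa using h2
  have h4 := h3.sqrt
  simpa [Real.sqrt_sq (norm_nonneg _)] using h4

theorem norm_scaling_le {s : Fin M → ℝ} (hs : ∀ n, s n ≤ 1) (x : Conf M) :
    ‖scaling s x‖ ≤ Real.exp 1 * ‖x‖ := by
  refine le_of_sq_le_sq ?_ (by positivity)
  rw [mul_pow, EuclideanSpace.norm_sq_eq, EuclideanSpace.norm_sq_eq, Finset.mul_sum]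
  refine Finset.sum_le_sum fun n _ => ?_
  rw [scaling_apply, norm_mul, mul_pow, Real.norm_of_nonneg (Real.exp_pos _).le]
  gcongr
  exact hs n

/-- Near `t = 0`, the dilates of a Schwartz function have a common square integrable majorant. -/
theorem exists_dilate_bound (n : Fin M) (φ : Core M) :
    ∃ g : Conf M → ℝ, Integrable (fun x => g x ^ 2) ∧
      ∀ t ∈ Metric.ball (0 : ℝ) 1, ∀ x, ‖dilate (Pi.single n t) φ x‖ ≤ g x := by
  set C : ℝ := 2 ^ (M + 1) *
    ((Finset.Iic (M + 1, 0)).sup fun m => SchwartzMap.seminorm ℂ m.1 m.2) φ with hC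
  have hCb : ∀ x, (1 + ‖x‖) ^ (M + 1) * ‖φ x‖ ≤ C := by
    intro x
    have := SchwartzMap.one_add_le_sup_seminorm_apply (𝕜 := ℂ) (m := (M + 1, 0)) le_rfl le_rfl φ x
    rwa [norm_iteratedFDeriv_zero] at this
  refine ⟨fun x => Real.exp 1 * (C * Real.exp 1 ^ (M + 1)) * ((1 + ‖x‖) ^ (M + 1))⁻¹, ?_, ?_⟩
  · have h := integrable_one_add_norm (E := Conf M) (μ := volume) (r := (2 * (M + 1) : ℕ)) (by
      rw [finrank_euclideanSpace_fin]; exact_mod_cast (by lia : M < 2 * (M + 1)))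
    refine (h.const_mul ((Real.exp 1 * (C * Real.exp 1 ^ (M + 1))) ^ 2)).congr
      (Eventually.of_forall fun x => ?_)
    simp only
    rw [Real.rpow_neg (by positivity), Real.rpow_natCast, mul_pow _ ((1 + ‖x‖) ^ (M + 1))⁻¹, inv_pow,
      ← pow_mul, mul_comm (M + 1) 2]
  · intro t ht x
    rw [mem_ball_zero_iff, Real.norm_eq_abs, abs_lt] at ht
    set y := scaling (Pi.single n t) x
    have e1 : x = scaling (Pi.single n (-t)) y := by
      rw [← scaling_add, ← Pi.single_add, add_neg_cancel, Pi.single_zero]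
      ext m
      simp
    have e2 : ‖x‖ ≤ Real.exp 1 * ‖y‖ := by
      conv_lhs => rw [e1]
      refine norm_scaling_le (fun m => ?_) y
      by_cases h : m = n
      · subst h; simp; linarith
      · simp [h]
    have e3 : 1 + ‖x‖ ≤ Real.exp 1 * (1 + ‖y‖) := by
      have : 1 ≤ Real.exp 1 := Real.one_le_exp zero_le_one
      nlinarith
    have e4 := hCb y
    rw [dilate_apply, norm_mul, Complex.norm_real, Real.norm_of_nonneg (Real.exp_pos _).le,
      Finset.sum_pi_single', if_pos (Finset.mem_univ n)]
    have e5 : ‖φ y‖ ≤ C * Real.exp 1 ^ (M + 1) * ((1 + ‖x‖) ^ (M + 1))⁻¹ := by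
      rw [← div_eq_mul_inv, le_div_iff₀ (by positivity)]
      calc ‖φ y‖ * (1 + ‖x‖) ^ (M + 1) ≤ ‖φ y‖ * (Real.exp 1 * (1 + ‖y‖)) ^ (M + 1) := by gcongr
        _ = ((1 + ‖y‖) ^ (M + 1) * ‖φ y‖) * Real.exp 1 ^ (M + 1) := by rw [mul_pow]; ring
        _ ≤ _ := by gcongr
    have e6 : Real.exp (t / 2) ≤ Real.exp 1 := Real.exp_le_exp.2 (by linarith)
    exact (mul_le_mul e6 e5 (norm_nonneg _) (Real.exp_pos 1).le).trans_eq (mul_assoc _ _ _).symm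

theorem hasDerivAt_incl_dilate (n : Fin M) (φ : Core M) (t : ℝ) :
    HasDerivAt (fun t => incl (dilate (Pi.single n t) φ))
      (incl (squeezeGen n (dilate (Pi.single n t) φ))) t := by
  have h0 : ∀ φ : Core M, HasDerivAt (fun t => incl (dilate (Pi.single n t) φ))
      (incl (squeezeGen n φ)) 0 := by
    intro φ
    obtain ⟨g, hg, hb⟩ := exists_dilate_bound n (squeezeGen n φ)
    have h := hasDerivAt_incl_of_dominated (fun t x => hasDerivAt_dilate_apply n φ x t) hg hb
    rwa [Pi.single_zero, dilate_zero] at h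
  have h1 := h0 (dilate (Pi.single n t) φ)
  have h2 : HasDerivAt (fun u : ℝ => u - t) 1 t := (hasDerivAt_id t).sub_const t
  have h3 := HasDerivAt.scomp_of_eq t h1 h2 (sub_self t).symm
  rw [one_smul] at h3
  refine h3.congr_of_eventuallyEq (Eventually.of_forall fun u => ?_)
  simp only [Function.comp]
  rw [← dilate_add, ← Pi.single_add, sub_add_cancel]

theorem isExpGroup_dilateOp (n : Fin M) :
    IsExpGroup (squeezeGen n) (fun t => dilateOp (Pi.single n t)) where
  map_zero := by rw [Pi.single_zero, dilateOp_zero]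
  map_add s t := by rw [Pi.single_add, dilateOp_add]
  norm_map t ψ := norm_dilateOp _ ψ
  continuous ψ := by
    refine continuous_of_uniform_approx_of_continuous fun u hu => ?_
    obtain ⟨ε, hε, hu⟩ := Metric.mem_uniformity_dist.1 hu
    obtain ⟨φ, hφ⟩ := Metric.denseRange_iff.1 denseRange_incl ψ ε hε
    refine ⟨fun t => incl (dilate (Pi.single n t) φ), continuous_iff_continuousAt.2 fun t =>
      (hasDerivAt_incl_dilate n φ t).continuousAt, fun t => hu ?_⟩
    change dist (dilateOp (Pi.single n t) ψ) (incl (dilate (Pi.single n t) φ)) < ε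
    rwa [← dilateOp_incl, dist_eq_norm, ← map_sub, norm_dilateOp, ← dist_eq_norm]
  hasDerivAt φ := by
    have h := hasDerivAt_incl_dilate n φ 0
    rw [Pi.single_zero, dilate_zero] at h
    simpa only [dilateOp_incl] using h

/-- A strongly continuous one-parameter group of isometries moves the initial value of a curve `w`
along `w` if it has the velocity of `w` at each point of `w`: the derivative of `t ↦ U (-t) (w t)`
vanishes. -/
theorem isometryGroup_apply_eq {X : Type*} [NormedAddCommGroup X] [NormedSpace ℂ X]
    {U : ℝ → (X →L[ℂ] X)} (h0 : U 0 = 1) (hadd : ∀ s t, U (s + t) = U s * U t)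
    (hnorm : ∀ t x, ‖U t x‖ = ‖x‖) (hcont : ∀ x, Continuous fun t => U t x) {w w' : ℝ → X}
    (hw : ∀ t, HasDerivAt w (w' t) t) (hU : ∀ t, HasDerivAt (fun h => U h (w t)) (w' t) 0)
    (t : ℝ) : U t (w 0) = w t := by
  have hd : ∀ t, HasDerivAt (fun t => U (-t) (w t)) 0 t := by
    intro t
    rw [hasDerivAt_iff_tendsto_slope_zero]
    set x : ℝ → X := fun h => h⁻¹ • (w (t + h) - w t) with hx
    have h1 : Tendsto (fun h => U (-(t + h)) (x h)) (𝓝[≠] 0) (𝓝 (U (-t) (w' t))) := by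
      have e1 : Tendsto (fun h => U (-(t + h)) (x h - w' t)) (𝓝[≠] 0) (𝓝 0) := by
        rw [tendsto_zero_iff_norm_tendsto_zero]
        simp_rw [hnorm]
        exact tendsto_iff_norm_sub_tendsto_zero.1 (hasDerivAt_iff_tendsto_slope_zero.1 (hw t))
      have e2 : Continuous fun h : ℝ => U (-(t + h)) (w' t) :=
        (hcont (w' t)).comp (by fun_prop)
      have e3 := e1.add ((e2.tendsto 0).mono_left nhdsWithin_le_nhds)
      simpa [← map_add] using e3
    have h2 : HasDerivAt (fun h : ℝ => U (-h) (w t)) (-w' t) 0 := by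
      have e := HasDerivAt.scomp_of_eq (0 : ℝ) (hU t) (hasDerivAt_neg (0 : ℝ)) neg_zero.symm
      simpa using! e
    have h5 := h1.add (((U (-t)).continuous.tendsto _).comp (hasDerivAt_iff_tendsto_slope_zero.1 h2))
    rw [map_neg, add_neg_cancel] at h5
    refine h5.congr fun h => ?_
    have e1 : ∀ y, U (-(t + h)) y = U (-t) (U (-h) y) := fun y => by
      rw [neg_add, hadd]
      rfl
    have e2 : ∀ y, U 0 y = y := fun y => by
      rw [h0]
      rfl
    simp only [hx, Function.comp, zero_add, neg_zero, e1, e2, map_sub,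
      ContinuousLinearMap.map_smul_of_tower, smul_sub]
    abel
  have hc := is_const_of_deriv_eq_zero (fun t => (hd t).differentiableAt)
    (fun t => (hd t).deriv) t 0
  simp only [neg_zero, h0] at hc
  have e : U t (U (-t) (w t)) = w t := by
    change (U t * U (-t)) (w t) = w t
    rw [← hadd, add_neg_cancel, h0]
    rfl
  rw [← e, hc]
  rfl

/-- Uniqueness of the exponential group on a curve of Schwartz functions that solves `v' = K v`. -/
theorem IsExpGroup.apply_eq_of_hasDerivAt {K : Core M →L[ℂ] Core M}
    {U : ℝ → (Hilb M →L[ℂ] Hilb M)} (hU : IsExpGroup K U) {v : ℝ → Core M}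
    (hv : ∀ t, HasDerivAt (fun t => incl (v t)) (incl (K (v t))) t) (t : ℝ) :
    U t (incl (v 0)) = incl (v t) :=
  isometryGroup_apply_eq hU.map_zero hU.map_add hU.norm_map hU.continuous hv
    (fun t => hU.hasDerivAt (v t)) t

/-- The exponential group exists, so `expGroup` does not take its default value. -/
theorem isExpGroup_squeezeOp (n : Fin M) : IsExpGroup (squeezeGen n) (squeezeOp n) := by
  have h : ∃ U, IsExpGroup (squeezeGen n) U := ⟨_, isExpGroup_dilateOp n⟩
  have e : squeezeOp n = h.choose := by
    funext r
    rw [squeezeOp, expGroup, dif_pos h]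
  rw [e]
  exact h.choose_spec

theorem squeezeOp_incl (n : Fin M) (r : ℝ) (φ : Core M) :
    squeezeOp n r (incl φ) = incl (dilate (Pi.single n r) φ) := by
  have h := (isExpGroup_squeezeOp n).apply_eq_of_hasDerivAt (hasDerivAt_incl_dilate n φ) r
  rwa [Pi.single_zero, dilate_zero] at h

/-- The squeezed vacuum is the dilated Gaussian. -/
theorem squeezedVacuum_eq (r : Fin M → ℝ) : squeezedVacuum r = incl (dilate r (vacS M)) := by
  have key : ∀ l : List (Fin M), (l.map fun n => squeezeOp n (r n)).prod (incl (vacS M)) =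
      incl (dilate (l.map fun n => Pi.single n (r n)).sum (vacS M)) := by
    intro l
    induction l with
    | nil => simp [dilate_zero]
    | cons n l ih =>
      rw [List.map_cons, List.prod_cons, List.map_cons, List.sum_cons, dilate_add,
        ← squeezeOp_incl, ← ih]
      rfl
  have h := key (List.finRange M)
  rw [← List.ofFn_eq_map, ← List.ofFn_eq_map, List.sum_ofFn, Finset.univ_sum_single] at h
  exact h

/-! ### The energy of the squeezed vacuum -/

/-- The characteristic function of the vacuum density, a standard Gaussian. -/
theorem integral_cos_mul_gauss_sq (lam : Fin M → ℝ) :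
    ∫ x, Real.cos (phase lam x) * gauss M x ^ 2 = Real.exp (-(1 / 2) * ∑ m, lam m ^ 2) := by
  set w : Conf M := WithLp.toLp 2 lam with hw
  have hb : 0 < ((1 / 2 : ℝ) : ℂ).re := by rw [Complex.ofReal_re]; norm_num
  have hphase : ∀ x : Conf M, phase lam x = ⟪w, x⟫ := by
    intro x
    rw [PiLp.inner_apply, phase]
    refine Finset.sum_congr rfl fun n _ => ?_
    simp [hw, mul_comm]
  have hint := GaussianFourier.integrable_cexp_neg_mul_sq_norm_add (V := Conf M) hb Complex.I w
  have hval := GaussianFourier.integral_cexp_neg_mul_sq_norm_add (V := Conf M) hb Complex.I w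
  have hnorm : ‖w‖ ^ 2 = ∑ m, lam m ^ 2 := by simp [EuclideanSpace.norm_sq_eq, hw]
  have hpi : (0 : ℝ) < 2 * Real.pi := by positivity
  have hrhs : ((Real.pi : ℂ) / ((1 / 2 : ℝ) : ℂ)) ^ ((Module.finrank ℝ (Conf M) : ℂ) / 2) *
      Complex.exp (Complex.I ^ 2 * (‖w‖ : ℂ) ^ 2 / (4 * ((1 / 2 : ℝ) : ℂ))) =
      (((2 * Real.pi) ^ ((M : ℝ) / 2) * Real.exp (-(1 / 2) * ∑ m, lam m ^ 2) : ℝ) : ℂ) := by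
    rw [Complex.ofReal_mul, Complex.ofReal_cpow hpi.le, Complex.ofReal_exp, ← hnorm,
      finrank_euclideanSpace_fin]
    push_cast
    rw [Complex.I_sq]
    congr 2 <;> ring
  have hre : ∀ x : Conf M,
      (Complex.exp (-((1 / 2 : ℝ) : ℂ) * (‖x‖ : ℂ) ^ 2 + Complex.I * (⟪w, x⟫ : ℝ))).re =
      Real.exp (-(‖x‖ ^ 2 / 2)) * Real.cos (phase lam x) := by
    intro x
    rw [Complex.exp_re, hphase]
    congr 2
    · simp [← Complex.ofReal_pow]
      ring
    · simp [← Complex.ofReal_pow]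
  have hsq : ((2 * Real.pi) ^ (-(M : ℝ) / 4)) ^ 2 * (2 * Real.pi) ^ ((M : ℝ) / 2) = 1 := by
    rw [← Real.rpow_natCast, ← Real.rpow_mul hpi.le, ← Real.rpow_add hpi]
    norm_num
    ring_nf
    exact Real.rpow_zero _
  have h1 : ∫ x : Conf M, Real.exp (-(‖x‖ ^ 2 / 2)) * Real.cos (phase lam x) =
      (2 * Real.pi) ^ ((M : ℝ) / 2) * Real.exp (-(1 / 2) * ∑ m, lam m ^ 2) := by
    simp_rw [← hre]
    have h2 := integral_re hint
    simp only [RCLike.re_to_complex] at h2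
    rw [h2, hval, hrhs, Complex.ofReal_re]
  have h3 : ∀ x : Conf M, Real.cos (phase lam x) * gauss M x ^ 2 =
      ((2 * Real.pi) ^ (-(M : ℝ) / 4)) ^ 2 *
        (Real.exp (-(‖x‖ ^ 2 / 2)) * Real.cos (phase lam x)) := by
    intro x
    rw [gauss, mul_pow, ← Real.exp_nat_mul]
    have : ((2 : ℕ) : ℝ) * -(‖x‖ ^ 2 / 4) = -(‖x‖ ^ 2 / 2) := by push_cast; ring
    rw [this]
    ring
  simp_rw [h3]
  rw [integral_const_mul, h1, ← mul_assoc, hsq, one_mul]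

theorem inner_vacS_cosPhase (lam : Fin M → ℝ) :
    inner ℂ (incl (vacS M)) (incl (cosPhase lam (vacS M))) =
      (Real.exp (-(1 / 2) * ∑ m, lam m ^ 2) : ℂ) := by
  rw [inner_incl, ← integral_cos_mul_gauss_sq, ← integral_complex_ofReal]
  congr 1
  ext x
  rw [cosPhase_apply, vacS_apply, Complex.conj_ofReal]
  push_cast
  ring

theorem norm_incl_vacS : ‖incl (vacS M)‖ = 1 := by
  have h := inner_vacS_cosPhase (0 : Fin M → ℝ)
  have h0 : cosPhase (0 : Fin M → ℝ) (vacS M) = vacS M := by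
    ext x
    simp [cosPhase_apply, phase]
  rw [h0, ← ofReal_norm_sq] at h
  have h1 : ‖incl (vacS M)‖ ^ 2 = 1 := by
    have : ((‖incl (vacS M)‖ ^ 2 : ℝ) : ℂ) = 1 := by
      push_cast
      rw [h]
      simp
    exact_mod_cast this
  exact (pow_eq_one_iff_of_nonneg (norm_nonneg _) two_ne_zero).1 h1

theorem halfPos_dilate (n : Fin M) (r : Fin M → ℝ) (φ : Core M) :
    halfPos n (dilate r φ) = (Real.exp (-r n) : ℂ) • dilate r (halfPos n φ) := by
  ext x
  rw [halfPos_apply, smul_apply, dilate_apply, dilate_apply, halfPos_apply, scaling_apply,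
    smul_eq_mul]
  have h : (Real.exp (-r n) : ℂ) * (Real.exp (r n) : ℂ) = 1 := by
    rw [← Complex.ofReal_mul, ← Real.exp_add, neg_add_cancel, Real.exp_zero, Complex.ofReal_one]
  push_cast at h ⊢
  linear_combination (-(x n / 2 : ℂ) * (Complex.exp ((∑ n, (r n : ℂ)) / 2) * φ (scaling r x))) * h

theorem partialD_dilate (n : Fin M) (r : Fin M → ℝ) (φ : Core M) :
    partialD n (dilate r φ) = (Real.exp (r n) : ℂ) • dilate r (partialD n φ) := by
  ext x
  have h1 : (dilate r φ : Conf M → ℂ) =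
      fun x => (Real.exp ((∑ n, r n) / 2) : ℂ) * φ (scaling r x) := funext (dilate_apply r φ)
  have h2 := ((φ.hasFDerivAt (scaling r x)).comp x (scaling r).hasFDerivAt).const_mul
    (Real.exp ((∑ n, r n) / 2) : ℂ)
  have h3 : scaling r (EuclideanSpace.single n 1) =
      Real.exp (r n) • EuclideanSpace.single n (1 : ℝ) := by
    ext m
    by_cases h : m = n
    · subst h; simp
    · simp [h]
  rw [smul_apply, dilate_apply, partialD_apply, partialD_apply, h1]
  refine (congrArg (fun L : Conf M →L[ℝ] ℂ => L (EuclideanSpace.single n 1)) h2.fderiv).trans ?_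
  change (Real.exp ((∑ n, r n) / 2) : ℂ) •
    fderiv ℝ φ (scaling r x) (scaling r (EuclideanSpace.single n 1)) = _
  rw [h3, map_smul, Complex.real_smul, smul_eq_mul, smul_eq_mul]
  ring

theorem cosPhase_dilate (lam r : Fin M → ℝ) (φ : Core M) :
    cosPhase lam (dilate r φ) = dilate r (cosPhase (fun n => lam n * Real.exp (-r n)) φ) := by
  ext x
  have h : phase lam x = phase (fun n => lam n * Real.exp (-r n)) (scaling r x) := by
    refine Finset.sum_congr rfl fun n _ => ?_
    rw [scaling_apply, mul_assoc, ← mul_assoc (Real.exp _), ← Real.exp_add, neg_add_cancel,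
      Real.exp_zero, one_mul]
  rw [cosPhase_apply, dilate_apply, dilate_apply, cosPhase_apply, h]
  ring

theorem norm_sq_halfPos_vacS (n : Fin M) : ‖incl (halfPos n (vacS M))‖ ^ 2 = 1 / 4 := by
  have h := norm_sq_creat n (vacS M)
  rw [annih_vacS, incl_zero, norm_zero, norm_incl_vacS] at h
  rw [halfPos_eq, annih_vacS, zero_add, incl_smul, norm_smul, mul_pow, h]
  norm_num

theorem annih_dilate_vacS (n : Fin M) (r : Fin M → ℝ) :
    annih n (dilate r (vacS M)) =
      ((-2 * Real.sinh (r n) : ℝ) : ℂ) • dilate r (halfPos n (vacS M)) := by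
  have h : partialD n (vacS M) = -halfPos n (vacS M) := by
    rw [eq_neg_iff_add_eq_zero, add_comm, ← annih_eq, annih_vacS]
  rw [annih_eq, halfPos_dilate, partialD_dilate, h, map_neg, smul_neg, ← sub_eq_add_neg, ← sub_smul,
    Real.sinh_eq]
  congr 1
  push_cast
  ring

theorem inner_number_dilate_vacS (n : Fin M) (r : Fin M → ℝ) :
    inner ℂ (incl (dilate r (vacS M))) (incl (creat n (annih n (dilate r (vacS M))))) =
      ((Real.sinh (r n) ^ 2 : ℝ) : ℂ) := by
  rw [← inner_annih, ← ofReal_norm_sq, annih_dilate_vacS, incl_smul, norm_smul, norm_incl_dilate,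
    Complex.norm_real, ← Complex.ofReal_pow, mul_pow, norm_sq_halfPos_vacS, Real.norm_eq_abs, sq_abs]
  congr 1
  ring

theorem inner_hamCore_dilate_vacS (hbar EJ : ℝ) (ω lam r : Fin M → ℝ) :
    inner ℂ (incl (dilate r (vacS M))) (incl (hamCore hbar EJ ω lam (dilate r (vacS M)))) =
      (varEnergy hbar EJ ω lam r : ℂ) := by
  have h : ∀ m, (lam m * Real.exp (-r m)) ^ 2 = lam m ^ 2 * Real.exp (-2 * r m) := by
    intro m
    rw [mul_pow, ← Real.exp_nat_mul]
    congr 2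
    push_cast
    ring
  rw [hamCore_apply, incl_sub, inner_sub_right, incl_smul, inner_smul_right, cosPhase_dilate,
    inner_dilate, inner_vacS_cosPhase, freeCore_apply, incl_sum, inner_sum]
  simp only [incl_smul, inner_smul_right, inner_number_dilate_vacS, h, varEnergy]
  push_cast
  rfl

theorem norm_squeezedVacuum (r : Fin M → ℝ) : ‖squeezedVacuum r‖ = 1 := by
  rw [squeezedVacuum_eq, norm_incl_dilate, norm_incl_vacS]

theorem exists_isHamImage_squeezedVacuum (hbar EJ : ℝ) (ω lam r : Fin M → ℝ) :
    ∃ χ : Hilb M, IsHamImage hbar EJ ω lam (squeezedVacuum r) χ ∧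
      inner ℂ (squeezedVacuum r) χ = (varEnergy hbar EJ ω lam r : ℂ) := by
  rw [squeezedVacuum_eq]
  exact ⟨_, isHamImage_incl _ _ _ _ _, inner_hamCore_dilate_vacS _ _ _ _ _⟩

theorem groundEnergy_le_varEnergy {hbar : ℝ} (EJ : ℝ) {ω : Fin M → ℝ} (lam r : Fin M → ℝ)
    (hh : 0 < hbar) (hω : ∀ n, 0 < ω n) :
    groundEnergy hbar EJ ω lam ≤ varEnergy hbar EJ ω lam r := by
  obtain ⟨χ, h1, h2⟩ := exists_isHamImage_squeezedVacuum hbar EJ ω lam r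
  have h3 := (groundEnergy_spec hbar EJ ω lam hh hω).2 _ _ h1
  rwa [norm_squeezedVacuum, h2, Complex.ofReal_re, one_pow, mul_one] at h3

/-! ### Existence of optimal squeezing parameters -/

theorem sq_le_sinh_sq (x : ℝ) : x ^ 2 ≤ Real.sinh x ^ 2 := by
  rw [← sq_abs x, ← sq_abs (Real.sinh x), Real.abs_sinh]
  exact pow_le_pow_left₀ (abs_nonneg x) (Real.self_le_sinh_iff.2 (abs_nonneg x)) 2

theorem exists_isOptimal {hbar EJ : ℝ} {ω : Fin M → ℝ} (lam : Fin M → ℝ) (hh : 0 < hbar)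
    (hE : 0 < EJ) (hω : ∀ n, 0 < ω n) : ∃ r, IsOptimal hbar EJ ω lam r := by
  have hcont : Continuous (varEnergy hbar EJ ω lam) := by
    unfold varEnergy
    fun_prop
  refine hcont.exists_forall_le' 0 ?_
  -- Outside the ball of radius `R` one free term alone exceeds `EJ`.
  set R : ℝ := ∑ n, EJ / (hbar * ω n) + 1 with hR
  have hterm : ∀ n, 0 ≤ EJ / (hbar * ω n) := fun n => (div_pos hE (mul_pos hh (hω n))).le
  have hR1 : 1 ≤ R := by linarith [Finset.sum_nonneg fun n (_ : n ∈ Finset.univ) => hterm n]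
  filter_upwards [(isCompact_closedBall (0 : Fin M → ℝ) R).compl_mem_cocompact] with s hs
  rw [Set.mem_compl_iff, mem_closedBall_zero_iff, pi_norm_le_iff_of_nonneg (by linarith)] at hs
  push Not at hs
  obtain ⟨n, hn⟩ := hs
  rw [Real.norm_eq_abs] at hn
  have h1 : EJ / (hbar * ω n) ≤ R := by
    have := Finset.single_le_sum (f := fun n => EJ / (hbar * ω n)) (fun n _ => hterm n)
      (Finset.mem_univ n)
    linarith
  have h2 : R ≤ Real.sinh (s n) ^ 2 := by
    refine le_trans ?_ (sq_le_sinh_sq (s n))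
    rw [← sq_abs]
    nlinarith
  have h3 : EJ ≤ hbar * ω n * Real.sinh (s n) ^ 2 := by
    rw [← div_le_iff₀' (mul_pos hh (hω n))]
    exact h1.trans h2
  have h4 : hbar * ω n * Real.sinh (s n) ^ 2 ≤ ∑ n, hbar * ω n * Real.sinh (s n) ^ 2 :=
    Finset.single_le_sum (f := fun n => hbar * ω n * Real.sinh (s n) ^ 2)
      (fun n _ => mul_nonneg (mul_pos hh (hω n)).le (sq_nonneg _)) (Finset.mem_univ n)
  have h5 : Real.exp (-(1 / 2) * ∑ m, lam m ^ 2 * Real.exp (-2 * s m)) ≤ 1 := by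
    rw [Real.exp_le_one_iff]
    have : 0 ≤ ∑ m, lam m ^ 2 * Real.exp (-2 * s m) := Finset.sum_nonneg fun m _ => by positivity
    linarith
  have h6 : varEnergy hbar EJ ω lam 0 ≤ 0 := by
    simp only [varEnergy, Pi.zero_apply, Real.sinh_zero]
    have := Real.exp_pos (-(1 / 2) * ∑ m, lam m ^ 2 * Real.exp (-2 * 0))
    simp only [ne_eq, OfNat.ofNat_ne_zero, not_false_eq_true, zero_pow, mul_zero,
      Finset.sum_const_zero, zero_sub] at this ⊢
    nlinarith
  refine h6.trans ?_
  unfold varEnergy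
  nlinarith

/-! ### One mode with a small coupling -/

theorem varEnergy_one (hbar EJ ω lam : ℝ) (r : Fin 1 → ℝ) :
    varEnergy hbar EJ (fun _ : Fin 1 => ω) (fun _ => lam) r =
      hbar * ω * Real.sinh (r 0) ^ 2 -
        EJ * Real.exp (-(1 / 2) * (lam ^ 2 * Real.exp (-2 * r 0))) := by
  simp [varEnergy]

theorem abs_sinh_sub_self_le {y : ℝ} (hy : |y| ≤ 1) : |Real.sinh y - y| ≤ y ^ 2 := by
  have h1 := abs_le.1 (Real.abs_exp_sub_one_sub_id_le hy)
  have h2 := abs_le.1 (Real.abs_exp_sub_one_sub_id_le (x := -y) (by rwa [abs_neg]))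
  rw [Real.sinh_eq, abs_le]
  constructor <;> nlinarith [h1.1, h1.2, h2.1, h2.2]

/-- The stationarity condition for the squeezing parameter. -/
theorem stationary_of_isOptimal {hbar EJ ω lam : ℝ} {r : Fin 1 → ℝ}
    (hr : IsOptimal hbar EJ (fun _ : Fin 1 => ω) (fun _ => lam) r) :
    hbar * ω * Real.sinh (2 * r 0) =
      EJ * lam ^ 2 * Real.exp (-2 * r 0 - 1 / 2 * (lam ^ 2 * Real.exp (-2 * r 0))) := by
  set f : ℝ → ℝ := fun x => hbar * ω * Real.sinh x ^ 2 -
    EJ * Real.exp (-(1 / 2) * (lam ^ 2 * Real.exp (-2 * x))) with hf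
  have hmin : IsLocalMin f (r 0) := by
    refine Eventually.of_forall fun x => ?_
    have h := hr fun _ => x
    rwa [varEnergy_one, varEnergy_one] at h
  have h1 : HasDerivAt (fun x : ℝ => Real.exp (-2 * x)) (Real.exp (-2 * r 0) * (-2 * 1)) (r 0) :=
    ((hasDerivAt_id (r 0)).const_mul (-2)).exp
  have hd : HasDerivAt f _ (r 0) :=
    (((Real.hasDerivAt_sinh (r 0)).pow 2).const_mul (hbar * ω)).sub
      ((((h1.const_mul (lam ^ 2)).const_mul (-(1 / 2))).exp).const_mul EJ)
  have h0 := hmin.hasDerivAt_eq_zero hd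
  rw [Real.sinh_two_mul, sub_eq_add_neg, Real.exp_add, ← neg_mul]
  push_cast at h0
  simp only [pow_one] at h0
  linarith

theorem optimal_squeezing_estimate {hbar EJ ω lam : ℝ} (hh : 0 < hbar) (hE : 0 < EJ) (hω : 0 < ω)
    (hsmall : EJ / (hbar * ω) * lam ^ 2 ≤ 1) {r : Fin 1 → ℝ}
    (hr : IsOptimal hbar EJ (fun _ : Fin 1 => ω) (fun _ => lam) r) :
    |r 0 - lam ^ 2 * EJ / (2 * hbar * ω)| ≤
      EJ / (hbar * ω) * (2 * (EJ / (hbar * ω)) + 1 / 2) * lam ^ 4 := by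
  have hst := stationary_of_isOptimal hr
  set κ := EJ / (hbar * ω) with hκ
  have hκ0 : 0 < κ := by positivity
  set x := r 0
  set u := Real.exp (-2 * x - 1 / 2 * (lam ^ 2 * Real.exp (-2 * x))) with hu
  have h1 : Real.sinh (2 * x) = κ * lam ^ 2 * u := by
    rw [hκ]
    field_simp
    linarith
  have hx0 : 0 ≤ 2 * x := Real.sinh_nonneg_iff.1 (by rw [h1]; positivity)
  have he1 : Real.exp (-2 * x) ≤ 1 := Real.exp_le_one_iff.2 (by linarith)
  have he0 := Real.exp_pos (-2 * x)
  have hl2 := sq_nonneg lam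
  have hu1 : u ≤ 1 := Real.exp_le_one_iff.2 (by nlinarith)
  have h2 : 2 * x ≤ κ * lam ^ 2 := by
    refine (Real.self_le_sinh_iff.2 hx0).trans ?_
    rw [h1]
    exact mul_le_of_le_one_right (by positivity) hu1
  have hu0 : 1 - (κ + 1 / 2) * lam ^ 2 ≤ u := by
    have := Real.add_one_le_exp (-2 * x - 1 / 2 * (lam ^ 2 * Real.exp (-2 * x)))
    rw [← hu] at this
    nlinarith
  have h3 := abs_le.1 (abs_sinh_sub_self_le (y := 2 * x)
    (by rw [abs_of_nonneg hx0]; linarith))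
  have h4 : (2 * x) ^ 2 ≤ (κ * lam ^ 2) ^ 2 := pow_le_pow_left₀ hx0 h2 2
  have h5 : κ * lam ^ 2 * (1 - (κ + 1 / 2) * lam ^ 2) ≤ Real.sinh (2 * x) := by
    rw [h1]
    gcongr
  have h6 : lam ^ 2 * EJ / (2 * hbar * ω) = κ * lam ^ 2 / 2 := by
    rw [hκ]
    field_simp
  have h7 : 0 ≤ κ * (2 * κ + 1 / 2) * lam ^ 4 := by positivity
  have h8 : κ * lam ^ 2 - κ * (2 * κ + 1 / 2) * lam ^ 4 ≤ 2 * x := by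
    have e : κ * lam ^ 2 - κ * (2 * κ + 1 / 2) * lam ^ 4 =
      κ * lam ^ 2 * (1 - (κ + 1 / 2) * lam ^ 2) - (κ * lam ^ 2) ^ 2 := by ring
    linarith [h3.2]
  rw [h6, abs_le]
  constructor <;> linarith

theorem numBasis_zero : numBasis M 0 = incl (vacS M) := by
  rw [numBasis_apply, numState_zero, norm_incl_vacS]
  simp

/-- `‖(1 - cos θ) |0⟩‖` is of second order in the coupling, since `1 - cos θ ≤ θ ^ 2 / 2`. -/
theorem norm_vacS_sub_cosPhase_le (lam : ℝ) :
    ‖incl (vacS 1 - cosPhase (fun _ : Fin 1 => lam) (vacS 1))‖ ≤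
      lam ^ 2 * (2 * ‖incl (halfPos 0 (halfPos 0 (vacS 1)))‖) := by
  have h : ‖incl (((lam ^ 2 * 2 : ℝ) : ℂ) • halfPos 0 (halfPos 0 (vacS 1)))‖ =
      lam ^ 2 * (2 * ‖incl (halfPos 0 (halfPos 0 (vacS 1)))‖) := by
    rw [incl_smul, norm_smul, Complex.norm_real, Real.norm_of_nonneg (by positivity), mul_assoc]
  rw [← h]
  refine norm_incl_le fun x => ?_
  have hp : phase (fun _ : Fin 1 => lam) x = lam * x 0 := by simp [phase]
  have e1 : (vacS 1 - cosPhase (fun _ : Fin 1 => lam) (vacS 1)) x =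
      ((1 - Real.cos (lam * x 0) : ℝ) : ℂ) * vacS 1 x := by
    rw [sub_apply, cosPhase_apply, hp]
    push_cast
    ring
  have e2 : (((lam ^ 2 * 2 : ℝ) : ℂ) • halfPos 0 (halfPos 0 (vacS 1))) x =
      (((lam * x 0) ^ 2 / 2 : ℝ) : ℂ) * vacS 1 x := by
    rw [smul_apply, halfPos_apply, halfPos_apply, smul_eq_mul]
    push_cast
    ring
  rw [e1, e2, norm_mul, norm_mul, Complex.norm_real, Complex.norm_real]
  refine mul_le_mul_of_nonneg_right ?_ (norm_nonneg _)
  rw [Real.norm_of_nonneg (by linarith [Real.cos_le_one (lam * x 0)]),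
    Real.norm_of_nonneg (by positivity)]
  linarith [Real.one_sub_sq_div_two_le_cos (x := lam * x 0)]

theorem exists_unit_ground_state {hbar : ℝ} (EJ : ℝ) {ω : Fin M → ℝ} (lam : Fin M → ℝ)
    (hh : 0 < hbar) (hω : ∀ n, 0 < ω n) :
    ∃ ψ : Hilb M, ‖ψ‖ = 1 ∧
      IsHamImage hbar EJ ω lam ψ ((groundEnergy hbar EJ ω lam : ℂ) • ψ) := by
  obtain ⟨ψ, h0, h⟩ := (groundEnergy_spec hbar EJ ω lam hh hω).1.1
  refine ⟨((‖ψ‖⁻¹ : ℝ) : ℂ) • ψ, ?_, fun φ => ?_⟩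
  · rw [norm_smul, Complex.norm_real, norm_inv, norm_norm, inv_mul_cancel₀ (norm_ne_zero_iff.2 h0)]
  · rw [smul_comm, inner_smul_right, inner_smul_right, h φ]

/-- The lower bound on the ground state energy that matches the energy of the unsqueezed vacuum up
to fourth order in the coupling. -/
theorem groundEnergy_lower_bound {hbar EJ ω lam : ℝ} (hh : 0 < hbar) (hE : 0 < EJ) (hω : 0 < ω)
    (hsmall : EJ * lam ^ 2 ≤ hbar * ω) :
    -EJ * Real.exp (-(1 / 2) * lam ^ 2) -
        2 * EJ ^ 2 * (2 * ‖incl (halfPos 0 (halfPos 0 (vacS 1)))‖) ^ 2 / (hbar * ω) * lam ^ 4 ≤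
      groundEnergy hbar EJ (fun _ : Fin 1 => ω) (fun _ => lam) := by
  obtain ⟨ψ, hψ, hψE⟩ := exists_unit_ground_state EJ (fun _ : Fin 1 => lam) hh (fun _ => hω)
  set E := groundEnergy hbar EJ (fun _ : Fin 1 => ω) (fun _ => lam)
  obtain ⟨hs, htot⟩ := ((isHamImage_iff _ _ _ _ _ _).1 hψE).totalForm_eq
  have hψψ : inner ℂ ψ ψ = (1 : ℂ) := by rw [← ofReal_norm_sq, hψ]; simp
  set W : Hilb 1 →L[ℂ] Hilb 1 := 1 - cosOp (fun _ => lam) with hW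
  have hWa : ∀ v, W v = v - cosOp (fun _ => lam) v := fun v => rfl
  have hWsymm : ∀ v w, inner ℂ (W v) w = inner ℂ v (W w) := by
    intro v w
    rw [hWa, hWa, inner_sub_left, inner_sub_right, inner_cosOp]
  have hWpos : ∀ v, 0 ≤ (inner ℂ v (W v)).re := by
    intro v
    rw [hWa, inner_sub_right, ← ofReal_norm_sq, Complex.sub_re, ← Complex.ofReal_pow,
      Complex.ofReal_re]
    have h1 := (Complex.abs_re_le_norm _).trans
      (norm_inner_le_norm (𝕜 := ℂ) v (cosOp (fun _ => lam) v))
    have h2 := norm_cosOp_le (fun _ => lam) v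
    have h3 := le_abs_self (inner ℂ v (cosOp (fun _ => lam) v)).re
    nlinarith [norm_nonneg v]
  have hWv : W (numBasis 1 0) = incl (vacS 1 - cosPhase (fun _ => lam) (vacS 1)) := by
    rw [numBasis_zero, hWa, cosOp_incl, incl_sub]
  have hw : (inner ℂ (numBasis 1 0) (W (numBasis 1 0))).re =
      1 - Real.exp (-(1 / 2) * lam ^ 2) := by
    rw [hWv, numBasis_zero, incl_sub, inner_sub_right, inner_vacS_cosPhase, ← ofReal_norm_sq,
      norm_incl_vacS, Finset.univ_unique, Finset.sum_singleton, Complex.sub_re, Complex.ofReal_re]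
    simp
  have hw2 : 2 * EJ * (inner ℂ (numBasis 1 0) (W (numBasis 1 0))).re ≤ hbar * ω := by
    rw [hw]
    have := Real.add_one_le_exp (-(1 / 2) * lam ^ 2)
    nlinarith
  have hgap : ∀ k : Fin 1 → ℕ, k ≠ 0 → hbar * ω ≤ freeLevel hbar (fun _ => ω) k := by
    intro k hk
    obtain ⟨n, hn⟩ := Function.ne_iff.1 hk
    refine le_trans ?_ (mul_le_freeLevel hh (fun _ => hω) k n)
    refine le_mul_of_one_le_right (by positivity) ?_
    exact_mod_cast Nat.one_le_iff_ne_zero.2 hn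
  have hmain := gap_lower_bound (freeLevel_nonneg hh fun _ => hω) (mul_pos hh hω) hgap hWsymm hWpos
    hE.le hw2 hψ hs
  have hd : ‖W (numBasis 1 0)‖ ^ 2 ≤
      (lam ^ 2 * (2 * ‖incl (halfPos 0 (halfPos 0 (vacS 1)))‖)) ^ 2 := by
    rw [hWv]
    exact pow_le_pow_left₀ (norm_nonneg _) (norm_vacS_sub_cosPhase_le lam) 2
  have hEq : ∑' k, diagTerm (numBasis 1) (freeLevel hbar fun _ => ω) ψ k +
      EJ * (inner ℂ ψ (W ψ)).re = E + EJ := by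
    rw [totalForm, inner_smul_right, hψψ, mul_one, Complex.ofReal_re, neg_apply, inner_neg_right,
      smul_apply, inner_smul_right, Complex.neg_re, Complex.re_ofReal_mul] at htot
    rw [hWa, inner_sub_right, hψψ, Complex.sub_re, Complex.one_re]
    linarith
  rw [hEq, hw] at hmain
  have hfin : 2 * EJ ^ 2 * ‖W (numBasis 1 0)‖ ^ 2 / (hbar * ω) ≤
      2 * EJ ^ 2 * (2 * ‖incl (halfPos 0 (halfPos 0 (vacS 1)))‖) ^ 2 / (hbar * ω) * lam ^ 4 := by
    rw [div_mul_eq_mul_div]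
    refine div_le_div_of_nonneg_right ?_ (by positivity)
    nlinarith [mul_le_mul_of_nonneg_left hd (by positivity : 0 ≤ 2 * EJ ^ 2)]
  linarith

/-- For a small coupling, the optimal squeezing parameter and its energy agree with
`lam ^ 2 * EJ / (2 * hbar * ω)` and the ground state energy to fourth order. -/
theorem exists_small_coupling_bounds {hbar EJ ω : ℝ} (hh : 0 < hbar) (hE : 0 < EJ) (hω : 0 < ω) :
    ∃ C > (0 : ℝ), ∃ δ > (0 : ℝ), ∀ lam : ℝ, |lam| < δ → ∀ r : Fin 1 → ℝ,
      IsOptimal hbar EJ (fun _ : Fin 1 => ω) (fun _ => lam) r →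
      |r 0 - lam ^ 2 * EJ / (2 * hbar * ω)| ≤ C * lam ^ 4 ∧
      |varEnergy hbar EJ (fun _ : Fin 1 => ω) (fun _ => lam) r -
        groundEnergy hbar EJ (fun _ : Fin 1 => ω) (fun _ => lam)| ≤ C * lam ^ 4 := by
  set C₁ := EJ / (hbar * ω) * (2 * (EJ / (hbar * ω)) + 1 / 2)
  set C₂ := 2 * EJ ^ 2 *
    (2 * ‖incl (halfPos 0 (halfPos 0 (vacS 1)))‖) ^ 2 / (hbar * ω)
  have hC₁ : 0 < C₁ := by positivity
  have hC₂ : 0 ≤ C₂ := by positivity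
  refine ⟨C₁ + C₂, by linarith, Real.sqrt (hbar * ω / EJ), by positivity, fun lam hlam r hr => ?_⟩
  have h1 : EJ * lam ^ 2 ≤ hbar * ω := by
    have h := Real.lt_sqrt (abs_nonneg lam) |>.1 hlam
    rw [sq_abs, lt_div_iff₀ hE] at h
    linarith
  have h2 : EJ / (hbar * ω) * lam ^ 2 ≤ 1 := by
    rw [div_mul_eq_mul_div, div_le_one (mul_pos hh hω)]
    exact h1
  have h4 : 0 ≤ lam ^ 4 := by positivity
  constructor
  · refine (optimal_squeezing_estimate hh hE hω h2 hr).trans ?_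
    exact mul_le_mul_of_nonneg_right (le_add_of_nonneg_right hC₂) h4
  · have g1 := groundEnergy_lower_bound hh hE hω h1
    have g2 := groundEnergy_le_varEnergy EJ (fun _ : Fin 1 => lam) r hh
      (fun _ => hω)
    -- The unsqueezed vacuum `r = 0` is a competitor of the minimizer.
    have g3 := hr 0
    rw [varEnergy_one hbar EJ ω lam 0] at g3
    simp only [Pi.zero_apply, Real.sinh_zero, mul_zero, Real.exp_zero, mul_one, ne_eq,
      OfNat.ofNat_ne_zero, not_false_eq_true, zero_pow, zero_sub] at g3
    rw [abs_of_nonneg (by linarith)]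
    have g4 : 0 ≤ C₁ * lam ^ 4 := by positivity
    linarith

end SqueezedVacuum

end

theorem proposition5 :
    (∀ (M : ℕ) (hbar EJ : ℝ) (ω lam : Fin M → ℝ), 0 < hbar → 0 < EJ → (∀ n, 0 < ω n) →
      IsLeast {E : ℝ | SqueezedVacuum.IsEnergyLevel hbar EJ ω lam E}
          (SqueezedVacuum.groundEnergy hbar EJ ω lam) ∧
      (∀ n : Fin M, SqueezedVacuum.IsExpGroup (SqueezedVacuum.squeezeGen n)
          (SqueezedVacuum.squeezeOp n)) ∧
      (∀ r : Fin M → ℝ, ‖SqueezedVacuum.squeezedVacuum r‖ = 1 ∧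
        ∃ χ : SqueezedVacuum.Hilb M,
          SqueezedVacuum.IsHamImage hbar EJ ω lam (SqueezedVacuum.squeezedVacuum r) χ ∧
          inner ℂ (SqueezedVacuum.squeezedVacuum r) χ =
            (SqueezedVacuum.varEnergy hbar EJ ω lam r : ℂ)) ∧
      (∃ r : Fin M → ℝ, SqueezedVacuum.IsOptimal hbar EJ ω lam r) ∧
      (∀ r : Fin M → ℝ, SqueezedVacuum.IsOptimal hbar EJ ω lam r →
        SqueezedVacuum.groundEnergy hbar EJ ω lam ≤ SqueezedVacuum.varEnergy hbar EJ ω lam r)) ∧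
    (∀ hbar EJ ω : ℝ, 0 < hbar → 0 < EJ → 0 < ω →
      ∃ C > (0 : ℝ), ∃ δ > (0 : ℝ), ∀ lam : ℝ, |lam| < δ → ∀ r : Fin 1 → ℝ,
        SqueezedVacuum.IsOptimal hbar EJ (fun _ : Fin 1 => ω) (fun _ => lam) r →
        |r 0 - lam ^ 2 * EJ / (2 * hbar * ω)| ≤ C * lam ^ 4 ∧
        |SqueezedVacuum.varEnergy hbar EJ (fun _ : Fin 1 => ω) (fun _ => lam) r -
          SqueezedVacuum.groundEnergy hbar EJ (fun _ : Fin 1 => ω) (fun _ => lam)| ≤ C * lam ^ 4) := by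
  exact ⟨fun M hbar EJ ω lam hh hE hω =>
    ⟨(SqueezedVacuum.groundEnergy_spec hbar EJ ω lam hh hω).1, SqueezedVacuum.isExpGroup_squeezeOp,
      fun r => ⟨SqueezedVacuum.norm_squeezedVacuum r,
        SqueezedVacuum.exists_isHamImage_squeezedVacuum hbar EJ ω lam r⟩,
      SqueezedVacuum.exists_isOptimal lam hh hE hω,
      fun r _ => SqueezedVacuum.groundEnergy_le_varEnergy EJ lam r hh hω⟩,
    fun hbar EJ ω hh hE hω => SqueezedVacuum.exists_small_coupling_bounds hh hE hω⟩
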